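/- **Setting.** A valued field is a field $K$ with a valuation ring $\mathcal O_K\subseteq K$; let $\mathcal M_K$ be its maximal ideal, $\operatorname{ord}\colon K^\times\to\Gamma=K^\times/\mathcal O_K^\times$ the valuation (of arbitrary rank, written additively), and $\operatorname{ord}0=\infty$. For an integer $N\ge 1$ put $\mathrm{RV}_N=K^\times/(1+N\mathcal M_K)\cup\{0\}$, and let $\mathrm{rv}_N\colon K\to \mathrm{RV}_N$ be the projection on $K^\times$ with $\mathrm{rv}_N(0)=0$; $\operatorname{ord}$ is well defined on $\mathrm{RV}_N$. For $\xi_0,\dots,\xi_n\in\mathrm{RV}_N$ let $\sum_i\xi_i$ be the subset $\{\mathrm{rv}_N(\sum_i x_i): \mathrm{rv}_N(x_i)=\xi_i\}$ of $\mathrm{RV}_N$, and for $S\subseteq \mathrm{RV}_N$ let $\operatorname{ord}S\le\gamma$ mean $\operatorname{ord}\eta\le\gamma$ for all $\eta\in S$. The language $\mathcal L_{\mathrm{RV}}$ has a sort $\mathrm{VF}$ (the valued field) and sorts $\mathrm{RV}_N$ ($N\ge1$), the ring language $\{0,1,+,-,\cdot\}$ on $\mathrm{VF}$, the symbols $0,1,\cdot$,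 a binary relation $\mid$ and a ternary relation $\oplus$ on each $\mathrm{RV}_N$, the maps $\mathrm{rv}_N\colon \mathrm{VF}\to \mathrm{RV}_N$, the projections $\mathrm{RV}_M\to \mathrm{RV}_N$ for $N\mid M$, and, for $N,d\ge1$, a relation $P_{N,d}$ on $\mathrm{RV}_N\times \mathrm{RV}_{N^2}^{d+1}$. In the natural $\mathcal L_{\mathrm{RV}}$-structure on a valued field $K$, $\mathrm{rv}_N(x)\mid \mathrm{rv}_N(y)$ means $\operatorname{ord}x\le\operatorname{ord}y$; $\oplus(\xi_1,\xi_2,\xi_3)$ means that there are $x_i\in K$ with $\mathrm{rv}_N(x_i)=\xi_i$ and $x_1+x_2=x_3$; and $P_{N,d}(\xi,\zeta_0,\dots,\zeta_d)$ means that for some (equivalently, all) $a_i\in K$ with $\mathrm{rv}_{N^2}(a_i)=\zeta_i$ the following hold: the $a_i$ are not all $0$, $\xi\ne0$, $$\operatorname{ord}\Big(\sum_{i=1}^d \mathrm{rv}_N(i a_i)\,\xi^{i-1}\Big)\le \min_{1\le i\le d}\operatorname{ord}(a_i\xi^{i-1})+\operatorname{ord}N,$$ and there is $\tilde\xi\in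 \mathrm{RV}_{N^2}$ with image $\xi$ in $\mathrm{RV}_N$ such that $0\in\sum_{i=0}^d \mathrm{rv}_{N^2}(a_i)\,\tilde\xi^{\,i}$. Let $T_{\mathrm{Hen},0}$ be the $\mathcal L_{\mathrm{RV}}$-theory of Henselian valued fields $K$ of characteristic $0$ with $\mathcal O_K\neq K$ (and arbitrary residue characteristic), with their natural structures. Let $\mathcal L$ be any expansion of $\mathcal L_{\mathrm{RV}}$ by constants (of any sort) and by function and relation symbols that only involve the sorts $\mathrm{RV}_N$, and let $T$ be any $\mathcal L$-theory expanding $T_{\mathrm{Hen},0}$. Free variables range over arbitrary finite products of sorts. An existential formula is a formula $\exists y\,\varphi(x,y)$ with $\varphi$ quantifier-free and $y$ a finite tuple of variables of any sorts; it is $\exists$-simple if no variable of $y$ is of sort $\mathrm{VF}$. **Theorem.** 1. Every existential $\mathcal L$-formula is equivalent modulo $T$ to an existential $\mathcal L$-formula without quantifiers over $\mathrm{VF}$, that is, to an $\exists$-simple formula in the same free variables. 2. In particular, every existentially definable set is $\exists$-simple: if $\mathcal K$ is a collection of models of $T$ and $X=(X_K)_{K\in\mathcal K}$ is a family of subsets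 of a finite product of sorts for which a single existential $\mathcal L$-formula defines $X_K$ in every $K\in\mathcal K$, then a single $\exists$-simple $\mathcal L$-formula defines $X_K$ in every $K\in\mathcal K$. 3. In particular (for $\mathcal L=\mathcal L_{\mathrm{RV}}$ and $T=T_{\mathrm{Hen},0}$), every existential $\mathcal L_{\mathrm{RV}}$-formula is equivalent modulo $T_{\mathrm{Hen},0}$ to an existential $\mathcal L_{\mathrm{RV}}$-formula without quantifiers over $\mathrm{VF}$. -/

import Mathlib

universe u v w

/-! ## Many-sorted first-order logic -/

namespace ManySorted

/-- A many-sorted signature with set of sorts `S`. Constants are function symbols of arity `0`. -/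
structure Signature (S : Type) where
  /-- function symbols -/
  Func : Type u
  /-- number of arguments of a function symbol -/
  arity : Func → ℕ
  /-- sorts of the arguments of a function symbol -/
  dom : (f : Func) → Fin (arity f) → S
  /-- sort of the value of a function symbol -/
  cod : Func → S
  /-- relation symbols (equality is a logical symbol and not listed here) -/
  Rel : Type u
  /-- number of arguments of a relation symbol -/
  relArity : Rel → ℕ
  /-- sorts of the arguments of a relation symbol -/
  relDom : (r : Rel) → Fin (relArity r) → S

/-- `Var Γ s` is the set of positions of the sort `s` in the list `Γ`. A list `Γ = [s₁, …, sₘ]` of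
sorts stands for a tuple of variables `(x₁, …, xₘ)` with `xᵢ` of sort `sᵢ`, and `Var Γ s` is then
the set of the variables of sort `s` in that tuple. -/
inductive Var {S : Type} : List S → S → Type
  | zero {Γ : List S} {s : S} : Var (s :: Γ) s
  | succ {Γ : List S} {s t : S} : Var Γ s → Var (t :: Γ) s

/-- The cartesian product `X s₁ × ⋯ × X sₘ`, for `Γ = [s₁, …, sₘ]`. -/
def Tuple {S : Type} (X : S → Type w) (Γ : List S) : Type w :=
  ∀ s, Var Γ s → X s

/-- The empty tuple. -/
def Tuple.nil {S : Type} {X : S → Type w} : Tuple X [] :=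
  fun _ x => nomatch x

/-- The tuple `(a, x₁, …, xₘ)`. -/
def Tuple.cons {S : Type} {X : S → Type w} {s : S} {Γ : List S} (a : X s) (v : Tuple X Γ) :
    Tuple X (s :: Γ)
  | _, .zero => a
  | _, .succ x => v _ x

/-- `Term L Γ s` is the set of `L`-terms of sort `s` in the variables `Γ`. -/
inductive Term {S : Type} (L : Signature.{u} S) (Γ : List S) : S → Type u
  | var {s : S} : Var Γ s → Term L Γ s
  | app (f : L.Func) : (∀ i, Term L Γ (L.dom f i)) → Term L Γ (L.cod f)

/-- `Formula L Γ` is the set of first-order `L`-formulas whose free variables are among `Γ`. A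
quantifier binds the first variable of the tuple `s :: Γ`. -/
inductive Formula {S : Type} (L : Signature.{u} S) : List S → Type u
  | falsum {Γ : List S} : Formula L Γ
  | eq {Γ : List S} {s : S} : Term L Γ s → Term L Γ s → Formula L Γ
  | rel {Γ : List S} (r : L.Rel) : (∀ i, Term L Γ (L.relDom r i)) → Formula L Γ
  | not {Γ : List S} : Formula L Γ → Formula L Γ
  | and {Γ : List S} : Formula L Γ → Formula L Γ → Formula L Γ
  | or {Γ : List S} : Formula L Γ → Formula L Γ → Formula L Γ
  | all {Γ : List S} (s : S) : Formula L (s :: Γ) → Formula L Γ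
  | ex {Γ : List S} (s : S) : Formula L (s :: Γ) → Formula L Γ

/-- A sentence is a formula without free variables. -/
abbrev Sentence {S : Type} (L : Signature.{u} S) : Type u := Formula L []

/-- A theory is a set of sentences. -/
abbrev Theory {S : Type} (L : Signature.{u} S) : Type u := Set (Sentence L)

/-- An `L`-structure. -/
structure Struct {S : Type} (L : Signature.{u} S) where
  /-- the interpretation of each sort -/
  carrier : S → Type w
  /-- the interpretation of each function symbol -/
  func : (f : L.Func) → (∀ i, carrier (L.dom f i)) → carrier (L.cod f)
  /-- the interpretation of each relation symbol -/
  rel : (r : L.Rel) → (∀ i, carrier (L.relDom r i)) → Prop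

/-- The value of a term under an assignment of the variables. -/
def Term.eval {S : Type} {L : Signature.{u} S} (M : Struct.{u, w} L) {Γ : List S}
    (v : Tuple M.carrier Γ) : {s : S} → Term L Γ s → M.carrier s
  | _, .var x => v _ x
  | _, .app f ts => M.func f (fun i => (ts i).eval M v)

/-- Tarski's truth definition: `φ.Holds M v` says that `M ⊨ φ(v)`. -/
def Formula.Holds {S : Type} {L : Signature.{u} S} (M : Struct.{u, w} L) :
    {Γ : List S} → Formula L Γ → Tuple M.carrier Γ → Prop
  | _, .falsum, _ => False
  | _, .eq t₁ t₂, v => t₁.eval M v = t₂.eval M v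
  | _, .rel r ts, v => M.rel r (fun i => (ts i).eval M v)
  | _, .not φ, v => ¬ φ.Holds M v
  | _, .and φ ψ, v => φ.Holds M v ∧ ψ.Holds M v
  | _, .or φ ψ, v => φ.Holds M v ∨ ψ.Holds M v
  | _, .all s φ, v => ∀ a : M.carrier s, φ.Holds M (Tuple.cons a v)
  | _, .ex s φ, v => ∃ a : M.carrier s, φ.Holds M (Tuple.cons a v)

/-- `φ(M)`, the set of the tuples that satisfy `φ` in `M`. -/
def Formula.solutions {S : Type} {L : Signature.{u} S} {Γ : List S} (φ : Formula L Γ)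
    (M : Struct.{u, w} L) : Set (Tuple M.carrier Γ) :=
  {v | φ.Holds M v}

/-- `M` is a model of `T`. -/
def Struct.IsModel {S : Type} {L : Signature.{u} S} (M : Struct.{u, w} L) (T : Theory L) : Prop :=
  ∀ σ ∈ T, Formula.Holds M σ Tuple.nil

/-- `φ` and `ψ` are equivalent modulo `T`: they define the same set in every model of `T`. -/
def EquivModulo {S : Type} {L : Signature.{u} S} (T : Theory L) {Γ : List S}
    (φ ψ : Formula L Γ) : Prop :=
  ∀ M : Struct.{u, w} L, M.IsModel T → φ.solutions M = ψ.solutions M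

/-- Quantifier-free formulas. -/
def Formula.IsQF {S : Type} {L : Signature.{u} S} : {Γ : List S} → Formula L Γ → Prop
  | _, .falsum => True
  | _, .eq _ _ => True
  | _, .rel _ _ => True
  | _, .not φ => φ.IsQF
  | _, .and φ ψ => φ.IsQF ∧ ψ.IsQF
  | _, .or φ ψ => φ.IsQF ∧ ψ.IsQF
  | _, .all _ _ => False
  | _, .ex _ _ => False

/-- The formulas `∃ y₁ ⋯ ∃ yₖ, φ` with `φ` quantifier-free, where `k ≥ 0` and all the sorts of the
quantified variables `y₁, …, yₖ` satisfy `Q`. -/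
inductive Formula.IsExistentialOver {S : Type} {L : Signature.{u} S} (Q : S → Prop) :
    {Γ : List S} → Formula L Γ → Prop
  | qf {Γ : List S} {φ : Formula L Γ} : φ.IsQF → Formula.IsExistentialOver Q φ
  | ex {Γ : List S} {s : S} {φ : Formula L (s :: Γ)} : Q s →
      Formula.IsExistentialOver Q φ → Formula.IsExistentialOver Q (Formula.ex s φ)

/-- An existential formula: a formula `∃ y, φ(x, y)` with `φ` quantifier-free and `y` a tuple of
variables of any sorts. -/
def Formula.IsExistential {S : Type} {L : Signature.{u} S} {Γ : List S} (φ : Formula L Γ) : Prop :=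
  φ.IsExistentialOver (fun _ => True)

end ManySorted

/-! ## Leading term structures of a valued field

A valued field is a field `K` with a valuation ring `A`. The valuation `A.valuation` of Mathlib is
written multiplicatively: `ord x ≤ ord y` reads `A.valuation y ≤ A.valuation x`, the sum
`ord x + ord y` reads `A.valuation x * A.valuation y`, and `ord 0 = ∞` reads
`A.valuation 0 = 0`. The maximal ideal of `A` is `{m | A.valuation m < 1}`. -/

namespace LeadingTerm

section

variable {K : Type u} [Field K] (A : ValuationSubring K)

theorem valuation_natCast_le_one (n : ℕ) : A.valuation (n : K) ≤ 1 :=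
  (A.valuation_le_one_iff _).2 (natCast_mem A n)

theorem valuation_one_add_mul {m : K} (N : ℕ) (hm : A.valuation m < 1) :
    A.valuation (1 + N * m) = 1 := by
  apply Valuation.map_one_add_of_lt
  rw [map_mul]
  exact mul_lt_one_of_nonneg_of_lt_one_right (valuation_natCast_le_one A N) zero_le hm

/-- The subgroup `1 + N 𝓜` of `Kˣ`. -/
def oneAddSubgroup (N : ℕ+) : Subgroup Kˣ where
  carrier := {u | ∃ m : K, A.valuation m < 1 ∧ (u : K) = 1 + ((N : ℕ) : K) * m}
  one_mem' := ⟨0, by simp, by simp⟩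
  mul_mem' := by
    rintro a b ⟨m, hm, ha⟩ ⟨n, hn, hb⟩
    refine ⟨m + n * (1 + ((N : ℕ) : K) * m), ?_, ?_⟩
    · refine A.valuation.map_add_lt hm ?_
      rw [map_mul, valuation_one_add_mul A N hm, mul_one]
      exact hn
    · rw [Units.val_mul, ha, hb]
      ring
  inv_mem' := by
    rintro a ⟨m, hm, ha⟩
    have hv : A.valuation (a : K) = 1 := by rw [ha, valuation_one_add_mul A N hm]
    refine ⟨-(m * ((a⁻¹ : Kˣ) : K)), ?_, ?_⟩
    · rw [Valuation.map_neg, map_mul, Units.val_inv_eq_inv_val, map_inv₀, hv, inv_one, mul_one]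
      exact hm
    · have h1 : ((a⁻¹ : Kˣ) : K) * (1 + ((N : ℕ) : K) * m) = 1 := by
        rw [← ha, Units.inv_mul]
      linear_combination h1

theorem oneAddSubgroup_le {N M : ℕ+} (h : N ∣ M) : oneAddSubgroup A M ≤ oneAddSubgroup A N := by
  rintro a ⟨m, hm, ha⟩
  obtain ⟨k, rfl⟩ := h
  refine ⟨((k : ℕ) : K) * m, ?_, ?_⟩
  · rw [map_mul]
    exact mul_lt_one_of_nonneg_of_lt_one_right (valuation_natCast_le_one A k) zero_le hm
  · rw [ha]
    push_cast
    ring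

/-- The leading term structure `RV_N = Kˣ / (1 + N 𝓜) ∪ {0}`, with its multiplication. -/
def LT (N : ℕ+) : Type u := WithZero (Kˣ ⧸ oneAddSubgroup A N)

noncomputable instance (N : ℕ+) : CommGroupWithZero (LT A N) :=
  inferInstanceAs (CommGroupWithZero (WithZero (Kˣ ⧸ oneAddSubgroup A N)))

/-- The class of a unit in `RV_N`. -/
def LT.mk (N : ℕ+) (u : Kˣ) : LT A N :=
  WithZero.coe (QuotientGroup.mk u : Kˣ ⧸ oneAddSubgroup A N)

open Classical in
/-- The map `rv_N : K → RV_N`: the projection on `Kˣ`, and `rv_N 0 = 0`. -/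
noncomputable def rv (N : ℕ+) (x : K) : LT A N :=
  if h : x = 0 then 0 else LT.mk A N (Units.mk0 x h)

/-- The projection `RV_M → RV_N`, for `N ∣ M`. -/
noncomputable def proj {N M : ℕ+} (h : N ∣ M) : LT A M →*₀ LT A N :=
  WithZero.map' (QuotientGroup.map _ _ (MonoidHom.id Kˣ) (oneAddSubgroup_le A h))

theorem valuation_eq_one_of_mem {N : ℕ+} {u : Kˣ} (hu : u ∈ oneAddSubgroup A N) :
    A.valuation (u : K) = 1 := by
  obtain ⟨m, hm, hu⟩ := hu
  rw [hu, valuation_one_add_mul A N hm]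

/-- The valuation on `RV_N` induced by that of `K`. -/
noncomputable def val (N : ℕ+) : LT A N →*₀ A.ValueGroup :=
  WithZero.lift' (QuotientGroup.lift (oneAddSubgroup A N)
    ((A.valuation : K →* A.ValueGroup).comp (Units.coeHom K))
    (fun _ hu => valuation_eq_one_of_mem A hu))

theorem rv_zero (N : ℕ+) : rv A N 0 = 0 := by simp [rv]

theorem rv_unit (N : ℕ+) (u : Kˣ) : rv A N u = LT.mk A N u := by
  rw [rv, dif_neg u.ne_zero, Units.mk0_val]

theorem rv_eq_zero (N : ℕ+) (x : K) : rv A N x = 0 ↔ x = 0 := by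
  refine ⟨fun h => ?_, fun h => by rw [h, rv_zero]⟩
  by_contra hx
  rw [rv, dif_neg hx] at h
  exact WithZero.coe_ne_zero h

theorem rv_mul (N : ℕ+) (x y : K) : rv A N (x * y) = rv A N x * rv A N y := by
  by_cases hx : x = 0
  · simp [hx, rv_zero]
  by_cases hy : y = 0
  · simp [hy, rv_zero]
  lift x to Kˣ using IsUnit.mk0 x hx
  lift y to Kˣ using IsUnit.mk0 y hy
  rw [← Units.val_mul, rv_unit, rv_unit, rv_unit]
  rfl

theorem rv_one (N : ℕ+) : rv A N 1 = 1 := by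
  rw [← Units.val_one, rv_unit]
  rfl

theorem val_rv (N : ℕ+) (x : K) : val A N (rv A N x) = A.valuation x := by
  by_cases h : x = 0
  · simp [h, rv_zero]
  · lift x to Kˣ using IsUnit.mk0 x h
    rw [rv_unit]
    rfl

theorem proj_rv {N M : ℕ+} (h : N ∣ M) (x : K) : proj A h (rv A M x) = rv A N x := by
  by_cases hx : x = 0
  · simp [hx, rv_zero]
  · lift x to Kˣ using IsUnit.mk0 x hx
    rw [rv_unit, rv_unit]
    rfl

/-- The relation `∣` on `RV_N`: `rv_N x ∣ rv_N y` if and only if `ord x ≤ ord y`. -/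
def LTDvd (N : ℕ+) (ξ η : LT A N) : Prop :=
  ∃ x y : K, rv A N x = ξ ∧ rv A N y = η ∧ A.valuation y ≤ A.valuation x

/-- The partial addition `⊕` on `RV_N`, as a ternary relation. -/
def Oplus (N : ℕ+) (ξ₁ ξ₂ ξ₃ : LT A N) : Prop :=
  ∃ x₁ x₂ x₃ : K, rv A N x₁ = ξ₁ ∧ rv A N x₂ = ξ₂ ∧ rv A N x₃ = ξ₃ ∧ x₁ + x₂ = x₃

/-- The sum `ξ₀ + ⋯ + ξₙ₋₁`, a subset of `RV_N`: the set of the leading terms of `x₀ + ⋯ + xₙ₋₁`,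
where `xᵢ` has leading term `ξᵢ`. It is the iterate of the partial addition, see
`hyperSum_zero` and `hyperSum_succ`. -/
def hyperSum {N : ℕ+} {n : ℕ} (ξ : Fin n → LT A N) : Set (LT A N) :=
  {η | ∃ x : Fin n → K, (∀ i, rv A N (x i) = ξ i) ∧ rv A N (∑ i, x i) = η}

theorem rv_mul_of_mem {N : ℕ+} {u : Kˣ} (hu : u ∈ oneAddSubgroup A N) (x : K) :
    rv A N (x * u) = rv A N x := by
  have h : rv A N u = 1 := by
    rw [rv_unit, LT.mk, (QuotientGroup.eq_one_iff u).2 hu]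
    rfl
  rw [rv_mul, h, mul_one]

theorem exists_of_rv_eq {N : ℕ+} {x y : K} (h : rv A N x = rv A N y) :
    ∃ u ∈ oneAddSubgroup A N, y = x * u := by
  by_cases hx : x = 0
  · rw [hx, rv_zero, eq_comm, rv_eq_zero] at h
    exact ⟨1, one_mem _, by simp [hx, h]⟩
  · have hy : y ≠ 0 := by
      rwa [ne_eq, ← rv_eq_zero A N, ← h, rv_eq_zero]
    lift x to Kˣ using IsUnit.mk0 x hx
    lift y to Kˣ using IsUnit.mk0 y hy
    rw [rv_unit, rv_unit] at h
    exact ⟨x⁻¹ * y, QuotientGroup.eq.1 (WithZero.coe_inj.1 h), by simp⟩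

theorem hyperSum_zero {N : ℕ+} (ξ : Fin 0 → LT A N) : hyperSum A ξ = {0} := by
  ext η
  simp [hyperSum, rv_zero, eq_comm]

theorem hyperSum_succ {N : ℕ+} {n : ℕ} (ξ : LT A N) (ζ : Fin n → LT A N) :
    hyperSum A (Fin.cons ξ ζ : Fin (n + 1) → LT A N) =
      {η | ∃ θ ∈ hyperSum A ζ, Oplus A N ξ θ η} := by
  ext η
  constructor
  · rintro ⟨x, hx, rfl⟩
    refine ⟨rv A N (∑ i : Fin n, x i.succ), ⟨fun i => x i.succ, fun i => ?_, rfl⟩,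
      x 0, ∑ i : Fin n, x i.succ, ∑ i, x i, ?_, rfl, rfl, (Fin.sum_univ_succ x).symm⟩
    · simpa using hx i.succ
    · simpa using hx 0
  · rintro ⟨θ, ⟨x, hx, rfl⟩, y, z, w, hy, hz, rfl, rfl⟩
    obtain ⟨u, hu, rfl⟩ := exists_of_rv_eq A hz.symm
    refine ⟨Fin.cons y (fun i => x i * u), ?_, ?_⟩
    · intro i
      refine Fin.cases ?_ (fun j => ?_) i
      · simpa using hy
      · simpa [rv_mul_of_mem A hu] using hx j
    · simp [Fin.sum_univ_succ, Finset.sum_mul]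

/-- The hypothesis of Hensel's lemma for the polynomial `f = ∑ aᵢ xⁱ` (of degree at most `d`) and
the leading term `ξ` in `RV_N`: `f` and `ξ` are nonzero,
`ord (∑_{i=1}^d rv_N(i aᵢ) ξ^{i-1}) ≤ min_{1 ≤ i ≤ d} ord (aᵢ ξ^{i-1}) + ord N`, and some lift `ξ'`
of `ξ` to `RV_{N²}` has `0 ∈ ∑_{i=0}^d rv_{N²}(aᵢ) ξ'^i`.
For a set `S` and a value `γ`, `ord S ≤ γ` means that `ord η ≤ γ` for all `η` in `S`.
The index `i` below runs over `0, …, d - 1` in place of `1, …, d`. -/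
def HenselCondition (N : ℕ+) (d : ℕ) (ξ : LT A N) (a : Fin (d + 1) → K) : Prop :=
  (∃ i, a i ≠ 0) ∧ ξ ≠ 0 ∧
  (∀ η ∈ hyperSum A (fun i : Fin d => rv A N ((((i : ℕ) + 1 : ℕ) : K) * a i.succ) * ξ ^ (i : ℕ)),
    ∀ i : Fin d,
      A.valuation (a i.succ) * val A N ξ ^ (i : ℕ) * A.valuation ((N : ℕ) : K) ≤ val A N η) ∧
  ∃ ξ' : LT A (N ^ 2), proj A (dvd_pow_self N two_ne_zero) ξ' = ξ ∧
    0 ∈ hyperSum A (fun i : Fin (d + 1) => rv A (N ^ 2) (a i) * ξ' ^ (i : ℕ))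

/-- The Hensel lift predicate `P_{N,d}` on `RV_N × (RV_{N²})^{d+1}`. -/
def HenselLift (N : ℕ+) (d : ℕ) (ξ : LT A N) (ζ : Fin (d + 1) → LT A (N ^ 2)) : Prop :=
  ∃ a : Fin (d + 1) → K, (∀ i, rv A (N ^ 2) (a i) = ζ i) ∧ HenselCondition A N d ξ a

end

/-! ## The language of leading terms -/

open ManySorted

/-- The sorts: the valued field sort and one leading term sort for each positive integer. -/
inductive Srt : Type
  | VF : Srt
  | RV : ℕ+ → Srt

/-- Function symbols of the language of leading terms. -/
inductive LRVFunc : Type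
  | zero | one | add | neg | mul
  | zeroRV (N : ℕ+) | oneRV (N : ℕ+) | mulRV (N : ℕ+)
  | rv (N : ℕ+)
  | proj (N M : ℕ+) (h : N ∣ M)

/-- Relation symbols of the language of leading terms. -/
inductive LRVRel : Type
  | dvd (N : ℕ+) | oplus (N : ℕ+) | P (N d : ℕ+)

/-- Number of arguments. -/
def LRVFunc.arity : LRVFunc → ℕ
  | .zero => 0 | .one => 0 | .add => 2 | .neg => 1 | .mul => 2
  | .zeroRV _ => 0 | .oneRV _ => 0 | .mulRV _ => 2
  | .rv _ => 1
  | .proj _ _ _ => 1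

/-- Sorts of the arguments. -/
def LRVFunc.dom : (f : LRVFunc) → Fin f.arity → Srt
  | .zero => fun _ => .VF
  | .one => fun _ => .VF
  | .add => fun _ => .VF
  | .neg => fun _ => .VF
  | .mul => fun _ => .VF
  | .zeroRV N => fun _ => .RV N
  | .oneRV N => fun _ => .RV N
  | .mulRV N => fun _ => .RV N
  | .rv _ => fun _ => .VF
  | .proj _ M _ => fun _ => .RV M

/-- Sort of the value. -/
def LRVFunc.cod : LRVFunc → Srt
  | .zero => .VF | .one => .VF | .add => .VF | .neg => .VF | .mul => .VF
  | .zeroRV N => .RV N | .oneRV N => .RV N | .mulRV N => .RV N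
  | .rv N => .RV N
  | .proj N _ _ => .RV N

/-- Number of arguments. -/
def LRVRel.arity : LRVRel → ℕ
  | .dvd _ => 2 | .oplus _ => 3 | .P _ d => (d : ℕ) + 2

/-- Sorts of the arguments; those of `P N d` are `RV_N` and `d + 1` times `RV_{N²}`. -/
def LRVRel.dom : (r : LRVRel) → Fin r.arity → Srt
  | .dvd N => fun _ => .RV N
  | .oplus N => fun _ => .RV N
  | .P N d => Fin.cons (n := (d : ℕ) + 1) (α := fun _ => Srt) (.RV N) (fun _ => .RV (N ^ 2))

/-- The language of leading terms. -/
def LRV : Signature.{0} Srt where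
  Func := LRVFunc
  arity := LRVFunc.arity
  dom := LRVFunc.dom
  cod := LRVFunc.cod
  Rel := LRVRel
  relArity := LRVRel.arity
  relDom := LRVRel.dom

section

variable {K : Type u} [Field K] (A : ValuationSubring K)

/-- The sorts in a valued field. -/
def carrier : Srt → Type u
  | .VF => K
  | .RV N => LT A N

/-- The function symbols in a valued field. -/
noncomputable def func : (f : LRVFunc) → (∀ i, carrier A (f.dom i)) → carrier A f.cod
  | .zero => fun _ => (0 : K)
  | .one => fun _ => (1 : K)
  | .add => fun (x : Fin 2 → K) => x 0 + x 1
  | .neg => fun (x : Fin 1 → K) => -x 0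
  | .mul => fun (x : Fin 2 → K) => x 0 * x 1
  | .zeroRV N => fun _ => (0 : LT A N)
  | .oneRV N => fun _ => rv A N 1
  | .mulRV N => fun (ξ : Fin 2 → LT A N) => ξ 0 * ξ 1
  | .rv N => fun (x : Fin 1 → K) => rv A N (x 0)
  | .proj _ M h => fun (ξ : Fin 1 → LT A M) => proj A h (ξ 0)

/-- The relation symbols in a valued field. -/
def rel : (r : LRVRel) → (∀ i, carrier A (r.dom i)) → Prop
  | .dvd N => fun (ξ : Fin 2 → LT A N) => LTDvd A N (ξ 0) (ξ 1)
  | .oplus N => fun (ξ : Fin 3 → LT A N) => Oplus A N (ξ 0) (ξ 1) (ξ 2)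
  | .P N d => fun ξ => HenselLift A N d (ξ (0 : Fin ((d : ℕ) + 2)))
      (fun i : Fin ((d : ℕ) + 1) => ξ i.succ)

/-- The natural structure on a valued field. -/
noncomputable def naturalStruct : Struct.{0, u} LRV where
  carrier := carrier A
  func := func A
  rel := rel A

end

/-- The theory of nontrivially valued Henselian fields of characteristic zero, in the language of
leading terms: the set of all the sentences that hold in the natural structures on such fields. -/
def THen0 : Theory LRV :=
  {σ | ∀ (K : Type u) [Field K] [CharZero K] (A : ValuationSubring K),
    A ≠ ⊤ → HenselianLocalRing A → σ.Holds (naturalStruct A) Tuple.nil}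

/-! ## Expansions that do not involve the valued field sort -/

/-- New symbols: constants of any sort, and function and relation symbols that only involve the
leading term sorts. -/
structure RVExpansion where
  /-- new constants -/
  Const : Type u
  /-- sort of a new constant -/
  constSort : Const → Srt
  /-- new function symbols -/
  Func : Type u
  /-- number of arguments of a new function symbol -/
  arity : Func → ℕ
  /-- the arguments of a new function symbol have the sorts `RV_N` for these `N` -/
  dom : (f : Func) → Fin (arity f) → ℕ+
  /-- the value of a new function symbol has the sort `RV_N` for this `N` -/
  cod : Func → ℕ+
  /-- new relation symbols -/
  Rel : Type u
  /-- number of arguments of a new relation symbol -/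
  relArity : Rel → ℕ
  /-- the arguments of a new relation symbol have the sorts `RV_N` for these `N` -/
  relDom : (r : Rel) → Fin (relArity r) → ℕ+

/-- The expansion of the language of leading terms by the new symbols. -/
def RVExpansion.lang (E : RVExpansion.{u}) : Signature.{u} Srt where
  Func := LRVFunc ⊕ (E.Const ⊕ E.Func)
  arity
    | .inl f => f.arity
    | .inr (.inl _) => 0
    | .inr (.inr f) => E.arity f
  dom
    | .inl f => f.dom
    | .inr (.inl _) => Fin.elim0
    | .inr (.inr f) => fun i => .RV (E.dom f i)
  cod
    | .inl f => f.cod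
    | .inr (.inl c) => E.constSort c
    | .inr (.inr f) => .RV (E.cod f)
  Rel := LRVRel ⊕ E.Rel
  relArity
    | .inl r => r.arity
    | .inr r => E.relArity r
  relDom
    | .inl r => r.dom
    | .inr r => fun i => .RV (E.relDom r i)

/-- The reduct of a structure to the language of leading terms. -/
def reduct {E : RVExpansion.{u}} (M : Struct.{u, w} E.lang) : Struct.{0, w} LRV where
  carrier := M.carrier
  func f := M.func (Sum.inl f)
  rel r := M.rel (Sum.inl r)

/-- `T` expands `T₀`: the sentences of `T₀` are consequences of `T`, that is, the reduct of every
model of `T` is a model of `T₀`. -/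
def Expands {E : RVExpansion.{u}} (T : Theory E.lang) (T₀ : Theory LRV) : Prop :=
  ∀ M : Struct.{u, w} E.lang, M.IsModel T → (reduct M).IsModel T₀

/-- An `∃`-simple formula: an existential formula without quantifiers over the valued field, that
is, a formula `∃ ξ, ψ(x, ξ)` with `ψ` quantifier-free and `ξ` a tuple of variables of leading term
sorts. -/
def IsExistsSimple {L : Signature.{u} Srt} {Γ : List Srt} (φ : Formula L Γ) : Prop :=
  φ.IsExistentialOver (fun s => s ≠ Srt.VF)

/-- For a collection `𝒦` of structures, a family `X = (X_M)` of subsets `X_M` of the product of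
sorts `Γ` in `M`, for `M` in `𝒦`, is existentially definable if one existential formula defines all
the sets `X_M`. -/
def IsExistentiallyDefinable {L : Signature.{u} Srt} (𝒦 : Set (Struct.{u, w} L)) {Γ : List Srt}
    (X : (M : 𝒦) → Set (Tuple M.1.carrier Γ)) : Prop :=
  ∃ φ : Formula L Γ, φ.IsExistential ∧ ∀ M : 𝒦, X M = φ.solutions M.1

/-- As before, with an `∃`-simple formula. -/
def IsExistsSimpleSet {L : Signature.{u} Srt} (𝒦 : Set (Struct.{u, w} L)) {Γ : List Srt}
    (X : (M : 𝒦) → Set (Tuple M.1.carrier Γ)) : Prop :=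
  ∃ φ : Formula L Γ, IsExistsSimple φ ∧ ∀ M : 𝒦, X M = φ.solutions M.1

end LeadingTerm

/-! ### Hensel's lemma in Newton's form -/

namespace LeadingTerm

open Polynomial

/-! The core is the elimination of `α` from `∃ α, θ(rv_M (p₁ α), …, rv_M (pₘ α))`, with polynomials
`pₖ` and an ∃-simple condition `θ`. Call `β` a center of `α` if, for a fixed integer `N₀`, each
Taylor term `cⱼ (α - β)^j` of `pₖ` at `β` satisfies `|cⱼ (α - β)^j| |N₀| ≤ |pₖ α|`. There is then no
large cancellation, and `rv_M (pₖ α)` is determined by the leading terms of `α - β` and of the `cⱼ`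
at any level divisible by `M N₀` (`rv_sum_congr`).

A center is found by taking the point nearest to `α` among `0` and the roots of all the nonzero
derivatives of the `pₖ`, of order zero included (`exists_center`). If the cancellation at `α` were
too large, Newton's form of Hensel's lemma would produce a root of `pₖ` nearer to `α`; the lower
bound on the derivative that this needs is the same estimate in smaller degree
(`valuation_taylor_le_of_nearest`). Integers that would be units in residue characteristic zero are
carried along as the factor `N₀`, which is nonzero in characteristic zero.

It remains to eliminate `β`, which is `0` or a root of a polynomial of bounded degree. This is an
induction on the degree (`rootElim`). For `α` a root of `g` of degree `d + 1`, pseudo-division by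
`g` brings the other polynomials down to degree at most `d`. A center `β` for these and for the
derivative of `g` is `0` or a root in degree at most `d`, and the induction hypothesis eliminates
it. That `α` is a root of `g` is read off at `β` from the predicate `P`, applied to the Taylor
coefficients of `g`: a root near its center satisfies `P` (`henselLift_of_root`), and `P` produces a
root (`exists_root_of_henselLift`).

Equivalences proved in all the fields are sentences of the theory, so they hold in every model. In
an expansion, a quantifier-free formula sees a field variable `α` only through finitely many `rv_M
(tₖ α)`, where the `tₖ` are polynomials. So only `∃ α, ⋀ rv_M (tₖ α) = ζₖ` has to be eliminated, and
this formula mentions no new symbol once the new constants are replaced by variables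
(`exists_simple_of_qf`). -/

theorem exists_root_of_coeff_mem_maximalIdeal {R : Type*} [CommRing R] [HenselianLocalRing R]
    (h : R[X]) (h0 : h.coeff 0 = 1) (h1 : h.coeff 1 = 1)
    (hk : ∀ k, 2 ≤ k → h.coeff k ∈ IsLocalRing.maximalIdeal R) : ∃ y, h.eval y = 0 := by
  -- The inverse of a unit root of the reverse of `h` is a root of `h`, and the reverse is monic
  -- because `h.coeff 0 = 1`.
  have hlead : h.reverse.Monic := by
    rw [Monic, reverse_leadingCoeff, trailingCoeff,
      natTrailingDegree_eq_zero.2 (Or.inr (by rw [h0]; exact one_ne_zero)), h0]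
  have hn : h.natDegree ≠ 0 := by
    intro hn
    have := coeff_eq_zero_of_natDegree_lt (p := h) (n := 1) (by omega)
    rw [h1] at this
    exact one_ne_zero this
  obtain ⟨n, hn⟩ := Nat.exists_eq_succ_of_ne_zero hn
  -- Over the residue field `h` becomes `1 + X`. The reverse is taken with respect to the degree `n
  -- + 1` of `h` itself, whence the factor `X ^ n`; the root `-1` is still simple.
  have hmap : h.reverse.map (IsLocalRing.residue R) = X ^ (n + 1) + X ^ n := by
    have e : h.map (IsLocalRing.residue R) = C 1 * X ^ 0 + C 1 * X ^ 1 := by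
      ext k
      rw [coeff_map]
      rcases k with _ | _ | k
      · simp [h0, coeff_X]
      · simp [h1, coeff_one]
      · have := (IsLocalRing.residue_eq_zero_iff _).2 (hk (k + 2) (by omega))
        simp [this, coeff_X, coeff_one]
    rw [reverse, ← reflect_map, e, reflect_add, reflect_C_mul_X_pow, reflect_C_mul_X_pow, hn,
      revAt_le (by omega), revAt_le (by omega)]
    simp
  have hroot : h.reverse.eval (-1) ∈ IsLocalRing.maximalIdeal R := by
    rw [← IsLocalRing.residue_eq_zero_iff, ← eval₂_hom, ← eval_map, hmap]
    simp [pow_succ]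
  have hder : IsUnit (h.reverse.derivative.eval (-1)) := by
    rw [← IsLocalRing.residue_ne_zero_iff_isUnit, ← eval₂_hom, ← eval_map, ← derivative_map, hmap]
    rcases n with _ | n
    · simp
    · simp [pow_succ]
      ring_nf
      simp
  obtain ⟨a, ha, ha'⟩ := HenselianLocalRing.is_henselian _ hlead (-1) hroot hder
  have hu : IsUnit a := by
    rw [← IsLocalRing.residue_ne_zero_iff_isUnit]
    rw [← IsLocalRing.residue_eq_zero_iff, map_sub, sub_eq_zero] at ha'
    simp [ha']
  obtain ⟨b, rfl⟩ := hu
  let : Invertible ((b⁻¹ : Rˣ) : R) := ⟨b, by simp, by simp⟩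
  refine ⟨((b⁻¹ : Rˣ) : R), ?_⟩
  exact (eval₂_reverse_eq_zero_iff (RingHom.id R) ((b⁻¹ : Rˣ) : R) h).1 ha

variable {K : Type u} [Field K] {A : ValuationSubring K}

theorem exists_root_of_coeff_lt (hA : HenselianLocalRing A) (h : K[X]) (h0 : h.coeff 0 = 1)
    (h1 : h.coeff 1 = 1) (hk : ∀ k, 2 ≤ k → A.valuation (h.coeff k) < 1) :
    ∃ y, h.eval y = 0 ∧ A.valuation y ≤ 1 := by
  have hmem : ∀ k, h.coeff k ∈ A := by
    intro k
    rcases k with _ | _ | k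
    · rw [h0]; exact one_mem _
    · rw [h1]; exact one_mem _
    · exact (A.valuation_le_one_iff _).1 (hk _ (by omega)).le
  have hl : h ∈ Polynomial.lifts (algebraMap A K) :=
    (lifts_iff_coeff_lifts h).2 fun k => ⟨⟨_, hmem k⟩, rfl⟩
  obtain ⟨g, rfl⟩ := (mem_lifts h).1 hl
  have hinj : Function.Injective (algebraMap A K) := Subtype.val_injective
  obtain ⟨y, hy⟩ := exists_root_of_coeff_mem_maximalIdeal g
    (hinj (by rw [← coeff_map, h0, map_one])) (hinj (by rw [← coeff_map, h1, map_one]))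
    (fun k h2 => (A.valuation_lt_one_iff _).2 (by simpa [coeff_map] using hk k h2))
  refine ⟨algebraMap A K y, ?_, A.valuation_le_one y⟩
  rw [eval_map, eval₂_hom, hy, map_zero]

/-- Hensel's lemma in Newton's form, at the point `1`. -/
theorem exists_root_near_one (hA : HenselianLocalRing A) (p : K[X]) (γ : A.ValueGroup)
    (hγ : ∀ j, A.valuation (p.coeff j) ≤ γ)
    (hp : A.valuation (p.eval 1) * γ < A.valuation (p.derivative.eval 1) ^ 2) :
    ∃ t, p.eval t = 0 ∧
      A.valuation (t - 1) * A.valuation (p.derivative.eval 1) ≤ A.valuation (p.eval 1) := by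
  by_cases h0 : p.eval 1 = 0
  · exact ⟨1, h0, by simp⟩
  -- The coefficients of Hasse derivatives are natural multiples of those of `p`, so `γ` also bounds
  -- the Taylor coefficients at `1`.
  have hT : ∀ k, A.valuation ((taylor 1 p).coeff k) ≤ γ := by
    intro k
    rw [taylor_coeff, eval_eq_sum]
    refine A.valuation.map_sum_le fun i _ => ?_
    dsimp only
    rw [one_pow, mul_one, hasseDeriv_coeff, map_mul]
    exact (mul_le_of_le_one_left' (valuation_natCast_le_one A _)).trans (hγ _)
  have hc1 : (taylor 1 p).coeff 1 = p.derivative.eval 1 := taylor_coeff_one ..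
  set a := p.eval 1 with ha
  set b := p.derivative.eval 1 with hb
  have hva : A.valuation a ≠ 0 := by simpa using h0
  have hb0 : b ≠ 0 := by
    intro h
    rw [h] at hp
    simp at hp
  have hvb : A.valuation b ≠ 0 := by simpa using hb0
  have hbγ : A.valuation b ≤ γ := hc1 ▸ hT 1
  have hab : A.valuation a < A.valuation b := by
    by_contra hcon
    push Not at hcon
    have : A.valuation b ^ 2 ≤ A.valuation a * γ := by
      rw [sq]; exact mul_le_mul' hcon hbγ
    exact absurd hp (not_lt.2 this)
  -- Up to sign, `s` is the Newton correction. Scaling the Taylor polynomial by `s` and dividing by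
  -- `a` gives `1 + Y + ⋯`, whose coefficients of index at least `2` have value at most `γ |a| /
  -- |b|² < 1`.
  set s := a / b with hs
  have hvs : A.valuation s < 1 := by
    rw [hs, map_div₀]
    exact (div_lt_one₀ (zero_lt_iff.2 hvb)).2 hab
  set h : K[X] := C a⁻¹ * (taylor 1 p).comp (C s * X) with hh
  have hcoeff : ∀ k, h.coeff k = a⁻¹ * ((taylor 1 p).coeff k * s ^ k) := by
    intro k
    rw [hh, coeff_C_mul, comp_C_mul_X_coeff]
  obtain ⟨y, hy, hvy⟩ := exists_root_of_coeff_lt hA h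
    (by rw [hcoeff, taylor_coeff_zero, ← ha]; simp [h0])
    (by rw [hcoeff, hc1, hs]; field_simp)
    (by
      intro k hk
      obtain ⟨k, rfl⟩ := Nat.exists_eq_add_of_le hk
      rw [hcoeff, pow_add, map_mul, map_mul, map_mul, map_pow A.valuation s k]
      have h1 : A.valuation a⁻¹ * (A.valuation ((taylor 1 p).coeff (2 + k)) * A.valuation (s ^ 2))
          < 1 := by
        have e : A.valuation (s ^ 2) = A.valuation a ^ 2 / A.valuation b ^ 2 := by
          rw [hs, map_pow, map_div₀, div_pow]
        rw [e, map_inv₀]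
        refine lt_of_le_of_lt (b := (A.valuation a)⁻¹ *
          (γ * (A.valuation a ^ 2 / A.valuation b ^ 2))) (by gcongr; exact hT _) ?_
        have : (A.valuation a)⁻¹ * (γ * (A.valuation a ^ 2 / A.valuation b ^ 2)) =
            (A.valuation a * γ) / A.valuation b ^ 2 := by
          field_simp
        rw [this]
        exact (div_lt_one₀ (zero_lt_iff.2 (pow_ne_zero _ hvb))).2 hp
      calc _ = A.valuation a⁻¹ * (A.valuation ((taylor 1 p).coeff (2 + k)) * A.valuation (s ^ 2))
            * A.valuation s ^ k := by simp only [mul_assoc]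
        _ ≤ A.valuation a⁻¹ * (A.valuation ((taylor 1 p).coeff (2 + k)) * A.valuation (s ^ 2))
            * 1 := by
          gcongr; exact pow_le_one' hvs.le k
        _ < 1 := by rwa [mul_one])
  refine ⟨1 + s * y, ?_, ?_⟩
  · have : a⁻¹ * (taylor 1 p).eval (s * y) = 0 := by
      have := hy
      rw [hh, eval_mul, eval_C, eval_comp] at this
      simpa using this
    rw [taylor_eval] at this
    rw [add_comm]
    exact (mul_eq_zero.1 this).resolve_left (inv_ne_zero h0)
  · have e : A.valuation s * A.valuation b = A.valuation a := by
      rw [← map_mul, hs, div_mul_cancel₀ _ hb0]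
    rw [add_sub_cancel_left, map_mul, mul_right_comm, e]
    exact mul_le_of_le_one_right' hvy

end LeadingTerm

/-! ### Centers and the control of cancellation -/

namespace LeadingTerm

open Polynomial

variable {K : Type u} [Field K] {A : ValuationSubring K}

theorem valuation_natCast_le_of_dvd {m n : ℕ} (h : m ∣ n) :
    A.valuation (n : K) ≤ A.valuation (m : K) := by
  obtain ⟨k, rfl⟩ := h
  rw [Nat.cast_mul, map_mul]
  exact mul_le_of_le_one_right' (valuation_natCast_le_one A k)

theorem valuation_pnat_ne_zero [CharZero K] (n : ℕ+) : A.valuation ((n : ℕ) : K) ≠ 0 := by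
  simp

theorem valuation_pnat_pos [CharZero K] (n : ℕ+) : 0 < A.valuation ((n : ℕ) : K) :=
  zero_lt_iff.2 (valuation_pnat_ne_zero n)

/-- The constant in the estimate of `valuation_taylor_le_of_nearest`. -/
def centerConst : ℕ → ℕ+
  | 0 => 1
  | n + 1 => (centerConst n * ⟨(n + 1).factorial, Nat.factorial_pos _⟩) ^ 2

/-- Differentiation kills the term of index `0`, so a large term is wanted elsewhere: a single large
term at `0` could not be cancelled. -/
theorem exists_succ_of_sum_lt {n : ℕ} (x : Fin (n + 1) → K) {γ : A.ValueGroup} (hγ : 0 < γ)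
    (hx : ∃ i, γ ≤ A.valuation (x i)) (hsum : A.valuation (∑ i, x i) < γ) :
    ∃ i : Fin n, γ ≤ A.valuation (x i.succ) := by
  by_contra! hcon
  have h1 : A.valuation (∑ i : Fin n, x i.succ) < γ :=
    A.valuation.map_sum_lt' hγ fun i _ => hcon i
  have h2 : A.valuation (x 0) < γ := by
    have : x 0 = ∑ i, x i - ∑ i : Fin n, x i.succ := by rw [Fin.sum_univ_succ]; ring
    rw [this]
    exact A.valuation.map_sub_lt hsum h1
  obtain ⟨i, hi⟩ := hx
  refine Fin.cases (fun hi => ?_) (fun j hj => ?_) i hi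
  · exact absurd h2 (not_lt.2 hi)
  · exact absurd (hcon j) (not_lt.2 hj)

theorem eval_one_eq_sum (p : K[X]) {n : ℕ} (hn : p.natDegree ≤ n) :
    p.eval 1 = ∑ i : Fin (n + 1), p.coeff i := by
  rw [eval_eq_sum_range' (Nat.lt_succ_of_le hn), Fin.sum_univ_eq_sum_range]
  simp

theorem derivative_taylor_comm (r : K) (q : K[X]) :
    derivative (taylor r q) = taylor r (derivative q) := by
  simp [taylor_apply, derivative_comp]

/-- If the estimate fails, Newton's lemma gives a root of `q` strictly nearer to `α` than `β`. The
derivative at `α` is large enough for this because `derivative q` inherits the hypothesis and has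
smaller degree. -/
theorem valuation_taylor_le_of_nearest [CharZero K] (hA : HenselianLocalRing A) (α β : K) (n : ℕ) :
    ∀ q : K[X], q.natDegree ≤ n →
      (∀ j γ, derivative^[j] q ≠ 0 → (derivative^[j] q).eval γ = 0 →
        A.valuation (α - β) ≤ A.valuation (α - γ)) →
      ∀ j, A.valuation ((taylor β q).coeff j) * A.valuation (α - β) ^ j *
        A.valuation ((centerConst n : ℕ) : K) ≤ A.valuation (q.eval α) := by
  induction n with
  | zero =>
    intro q hq _ j
    obtain ⟨c, rfl⟩ := natDegree_eq_zero.1 (Nat.le_zero.1 hq)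
    rcases j with _ | j
    · simp [centerConst]
    · simp
  | succ n ih =>
    intro q hq hβ
    by_cases hz : α = β
    · subst hz
      intro j
      rcases j with _ | j
      · rw [taylor_coeff_zero, pow_zero, mul_one]
        exact mul_le_of_le_one_right' (valuation_natCast_le_one A _)
      · simp
    by_contra! hcon
    obtain ⟨j₀, hj₀⟩ := hcon
    set z := α - β with hzdef
    have hz0 : z ≠ 0 := sub_ne_zero.2 hz
    -- The induction hypothesis costs `centerConst n`, differentiation costs a factor `i + 1`
    -- dividing `(n + 1)!`, and Newton's inequality squares the product. This is the recursion of
    -- `centerConst`.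
    set κ := A.valuation ((centerConst n * ⟨(n + 1).factorial, Nat.factorial_pos _⟩ : ℕ+) : K)
      with hκ
    have hκN : A.valuation ((centerConst (n + 1) : ℕ) : K) = κ ^ 2 := by
      rw [hκ, centerConst]; push_cast; simp
    have hκ1 : κ ≤ 1 := valuation_natCast_le_one A _
    -- In the coordinate of `p` the points `β` and `α` are `0` and `1`, and the Taylor terms at `α`
    -- are the coefficients.
    set p := (taylor β q).comp (C z * X) with hp
    have hpc : ∀ k, p.coeff k = (taylor β q).coeff k * z ^ k := fun k => comp_C_mul_X_coeff
    have hpeval : ∀ t, p.eval t = q.eval (z * t + β) := by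
      intro t
      rw [hp, eval_comp, taylor_eval]
      simp
    have hp1 : p.eval 1 = q.eval α := by
      rw [hpeval, hzdef]; congr 1; ring
    have hpd : p.natDegree ≤ n + 1 := by
      refine natDegree_le_iff_coeff_eq_zero.2 fun k hk => ?_
      rw [hpc, coeff_eq_zero_of_natDegree_lt (by rw [natDegree_taylor]; omega), zero_mul]
    have hpd1 : p.derivative.eval 1 = z * q.derivative.eval α := by
      rw [hp, derivative_comp, derivative_taylor_comm, eval_mul, eval_comp, taylor_eval]
      simp [hzdef]
    obtain ⟨i₀, -, hi₀⟩ := Finset.exists_max_image (Finset.univ : Finset (Fin (n + 2)))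
      (fun i => A.valuation (p.coeff i)) ⟨0, Finset.mem_univ _⟩
    set γ := A.valuation (p.coeff i₀) with hγ
    have hle : ∀ k, A.valuation (p.coeff k) ≤ γ := by
      intro k
      by_cases hk : k < n + 2
      · exact hi₀ ⟨k, hk⟩ (Finset.mem_univ _)
      · rw [coeff_eq_zero_of_natDegree_lt (by omega), map_zero]
        exact zero_le
    have hlt : A.valuation (p.eval 1) < γ * κ ^ 2 := by
      rw [hp1, ← hκN]
      refine hj₀.trans_le ?_
      gcongr
      rw [← map_pow, ← map_mul, ← hpc]
      exact hle _
    have hlt' : A.valuation (p.eval 1) < γ :=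
      hlt.trans_le (mul_le_of_le_one_right' (pow_le_one' hκ1 2))
    have hγ0 : 0 < γ := lt_of_le_of_lt zero_le hlt'
    obtain ⟨i, hi⟩ := exists_succ_of_sum_lt (fun i : Fin (n + 2) => p.coeff i) hγ0 ⟨i₀, le_rfl⟩
      (by rw [← eval_one_eq_sum p hpd]; exact hlt')
    have hder : γ * κ ≤ A.valuation (p.derivative.eval 1) := by
      have h1 := ih (derivative q) (natDegree_derivative_le q |>.trans (by omega))
        (fun j γ h1 h2 => hβ (j + 1) γ (by rwa [Function.iterate_succ_apply])
          (by rwa [Function.iterate_succ_apply])) i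
      rw [← derivative_taylor_comm, coeff_derivative] at h1
      rw [hpd1, map_mul]
      refine le_trans ?_ (mul_le_mul_right h1 (A.valuation z))
      have h2 : A.valuation (((n + 1).factorial : ℕ) : K) ≤ A.valuation ((i : K) + 1) := by
        have := valuation_natCast_le_of_dvd (A := A) (K := K) (m := i + 1) (n := (n + 1).factorial)
          (Nat.dvd_factorial (by omega) (by omega))
        simpa using this
      have h3 : κ = A.valuation ((centerConst n : ℕ) : K) *
          A.valuation (((n + 1).factorial : ℕ) : K) := by
        rw [hκ, ← map_mul, ← Nat.cast_mul]; rfl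
      rw [hpc, Fin.val_succ, map_mul, map_pow] at hi
      calc γ * κ ≤ A.valuation ((taylor β q).coeff (i + 1)) * A.valuation z ^ ((i : ℕ) + 1) *
            (A.valuation ((centerConst n : ℕ) : K) * A.valuation ((i : K) + 1)) := by
              rw [h3]; gcongr
        _ = _ := by rw [map_mul, pow_succ]; ac_rfl
    obtain ⟨t, ht, ht1⟩ := exists_root_near_one hA p γ hle (by
      calc A.valuation (p.eval 1) * γ < (γ * κ ^ 2) * γ := by gcongr
        _ = (γ * κ) ^ 2 := by rw [mul_pow, sq γ]; ac_rfl
        _ ≤ _ := by gcongr)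
    -- Otherwise `|p' 1| ≤ |p 1|`, against `|p 1| < γ κ² ≤ γ κ ≤ |p' 1|`.
    have hvt : A.valuation (t - 1) < 1 := by
      by_contra! hcon
      have h1 : A.valuation (p.derivative.eval 1) ≤ A.valuation (p.eval 1) :=
        le_trans (le_mul_of_one_le_left' hcon) ht1
      have h2 : γ * κ ^ 2 ≤ γ * κ := by
        rw [sq]; gcongr; exact mul_le_of_le_one_right' hκ1
      exact absurd (hlt.trans_le (h2.trans hder)) (not_lt.2 h1)
    have hq0 : q ≠ 0 := by
      rintro rfl
      simp at hj₀
    -- The new root has distance `|z| |t - 1| < |z|` from `α`, which contradicts the choice of `β`.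
    have hfin := hβ 0 (z * t + β) hq0 (by rw [Function.iterate_zero_apply, ← hpeval, ht])
    have e : α - (z * t + β) = -(z * (t - 1)) := by rw [hzdef]; ring
    rw [e, Valuation.map_neg, map_mul] at hfin
    have : A.valuation z * A.valuation (t - 1) < A.valuation z * 1 := by
      gcongr
      exact zero_lt_iff.2 (by simpa using hz0)
    rw [mul_one] at this
    exact absurd this (not_lt.2 hfin)

/-- Every point `α` has a center `β` among `0` and the roots of the derivatives of the given
polynomials such that the Taylor expansions at `β` have no large cancellation at `α`. -/
theorem exists_center [CharZero K] (hA : HenselianLocalRing A) {κ : Type*} [Finite κ] (f : κ → K[X])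
    (n : ℕ) (hf : ∀ k, (f k).natDegree ≤ n) (α : K) :
    ∃ β : K, (β = 0 ∨ ∃ (k : κ) (j : Fin (n + 1)), derivative^[j] (f k) ≠ 0 ∧
        (derivative^[j] (f k)).eval β = 0) ∧
      ∀ k j, A.valuation ((taylor β (f k)).coeff j) * A.valuation (α - β) ^ j *
        A.valuation ((centerConst n : ℕ) : K) ≤ A.valuation ((f k).eval α) := by
  -- The point `0` keeps the set nonempty when no derivative has a root in `K`.
  let s : Set K := insert 0 (⋃ (k : κ) (j : Fin (n + 1)), {β | β ∈ (derivative^[j] (f k)).roots})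
  have hs : s.Finite := by
    refine Set.Finite.insert _ (Set.finite_iUnion fun k => Set.finite_iUnion fun j => ?_)
    exact Multiset.finite_toSet _
  obtain ⟨β, hβs, hβ⟩ := Set.exists_min_image s (fun β => A.valuation (α - β)) hs
    ⟨0, Set.mem_insert _ _⟩
  refine ⟨β, ?_, fun k => ?_⟩
  · rcases hβs with h | h
    · exact Or.inl h
    · simp only [Set.mem_iUnion, Set.mem_ofPred_eq] at h
      obtain ⟨k, j, h⟩ := h
      rw [mem_roots'] at h
      exact Or.inr ⟨k, j, h⟩
  · refine valuation_taylor_le_of_nearest hA α β n (f k) (hf k) fun j γ h0 h1 => hβ _ ?_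
    have hj : j < n + 1 := by
      by_contra! hj
      exact h0 (iterate_derivative_eq_zero (lt_of_le_of_lt (hf k) (by omega)))
    refine Set.mem_insert_of_mem _ ?_
    simp only [Set.mem_iUnion, Set.mem_ofPred_eq]
    exact ⟨k, ⟨j, hj⟩, (mem_roots h0).2 h1⟩

theorem rv_eq_iff [CharZero K] {N : ℕ+} {x y : K} :
    rv A N x = rv A N y ↔
      x = y ∨ A.valuation (y - x) < A.valuation ((N : ℕ) : K) * A.valuation x := by
  constructor
  · intro h
    by_cases hx : x = 0
    · left
      rw [hx, rv_zero, eq_comm, rv_eq_zero] at h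
      rw [hx, h]
    right
    obtain ⟨u, ⟨m, hm, hu⟩, rfl⟩ := exists_of_rv_eq A h
    have : x * (u : K) - x = ((N : ℕ) : K) * x * m := by rw [hu]; ring
    rw [this, map_mul, map_mul]
    refine mul_lt_of_lt_one_right ?_ hm
    exact mul_pos (valuation_pnat_pos N) (zero_lt_iff.2 (by simpa using hx))
  · rintro (rfl | h)
    · rfl
    have hx : x ≠ 0 := by
      rintro rfl
      simp at h
    have hN : ((N : ℕ) : K) ≠ 0 := by simp
    set m := (y - x) / (((N : ℕ) : K) * x) with hm
    have hvm : A.valuation m < 1 := by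
      rw [hm, map_div₀, map_mul]
      refine (div_lt_one₀ ?_).2 h
      exact mul_pos (valuation_pnat_pos N) (zero_lt_iff.2 (by simpa using hx))
    have hu : y = x * (1 + ((N : ℕ) : K) * m) := by
      rw [hm]; field_simp; ring
    have hne : 1 + ((N : ℕ) : K) * m ≠ 0 := by
      intro h0
      have := valuation_one_add_mul A N hvm
      rw [h0, map_zero] at this
      exact zero_ne_one this
    have := rv_mul_of_mem A (N := N) (u := Units.mk0 _ hne) ⟨m, hvm, rfl⟩ x
    rw [Units.val_mk0, ← hu] at this
    exact this.symm

theorem valuation_eq_of_rv_eq {N : ℕ+} {x y : K} (h : rv A N x = rv A N y) :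
    A.valuation x = A.valuation y := by
  rw [← val_rv A N x, h, val_rv]

theorem rv_eq_of_dvd {N M : ℕ+} (hNM : N ∣ M) {x y : K} (h : rv A M x = rv A M y) :
    rv A N x = rv A N y := by
  rw [← proj_rv A hNM x, h, proj_rv]

theorem rv_pow (N : ℕ+) (x : K) (n : ℕ) : rv A N (x ^ n) = rv A N x ^ n := by
  induction n with
  | zero => rw [pow_zero, pow_zero, rv_one]
  | succ n ih => rw [pow_succ, pow_succ, rv_mul, ih]

theorem rv_surjective (N : ℕ+) : Function.Surjective (rv A N) := by
  intro ξ
  by_cases h : ξ = 0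
  · exact ⟨0, by rw [h, rv_zero]⟩
  · obtain ⟨q, rfl⟩ := WithZero.ne_zero_iff_exists.1 h
    obtain ⟨u, rfl⟩ := QuotientGroup.mk_surjective q
    exact ⟨u, rv_unit A N u⟩

/-- Each nonzero term changes by less than `|M| |xᵢ| ≤ |N| |N₀| |xᵢ| ≤ |N| |∑ xᵢ|`. The absence of
large cancellation is needed for only one of the two families. -/
theorem rv_sum_congr [CharZero K] {N N₀ M : ℕ+} (hM : N * N₀ ∣ M) {κ : Type*} [Fintype κ]
    {x y : κ → K} (hxy : ∀ i, rv A M (x i) = rv A M (y i))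
    (hx : ∀ i, A.valuation (x i) * A.valuation ((N₀ : ℕ) : K) ≤ A.valuation (∑ i, x i)) :
    rv A N (∑ i, x i) = rv A N (∑ i, y i) := by
  by_cases h0 : ∑ i, x i = 0
  · have hx0 : ∀ i, x i = 0 := by
      intro i
      have := hx i
      rw [h0, map_zero, le_zero_iff, mul_eq_zero] at this
      simpa using this.resolve_right (valuation_pnat_ne_zero N₀)
    have hy0 : ∀ i, y i = 0 := by
      intro i
      have := hxy i
      rw [hx0, rv_zero, eq_comm, rv_eq_zero] at this
      exact this
    simp [hx0, hy0]
  · rw [rv_eq_iff]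
    right
    rw [← Finset.sum_sub_distrib]
    have hpos : 0 < A.valuation ((N : ℕ) : K) * A.valuation (∑ i, x i) :=
      mul_pos (valuation_pnat_pos N) (zero_lt_iff.2 (by simpa using h0))
    refine A.valuation.map_sum_lt' hpos fun i _ => ?_
    rcases rv_eq_iff.1 (hxy i) with h | h
    · rw [h, sub_self, map_zero]
      exact hpos
    · refine h.trans_le ?_
      have h1 : A.valuation ((M : ℕ) : K) ≤
          A.valuation ((N : ℕ) : K) * A.valuation ((N₀ : ℕ) : K) := by
        rw [← map_mul, ← Nat.cast_mul, ← PNat.mul_coe]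
        exact valuation_natCast_le_of_dvd (PNat.dvd_iff.1 hM)
      calc _ ≤ A.valuation ((N : ℕ) : K) * A.valuation ((N₀ : ℕ) : K) * A.valuation (x i) := by
            gcongr
        _ = A.valuation ((N : ℕ) : K) * (A.valuation (x i) * A.valuation ((N₀ : ℕ) : K)) := by
            ac_rfl
        _ ≤ _ := by gcongr; exact hx i

end LeadingTerm

/-! ### The Hensel lift predicate and roots -/

namespace LeadingTerm

open Polynomial

variable {K : Type u} [Field K] {A : ValuationSubring K}

theorem ltDvd_iff {N : ℕ+} {ξ η : LT A N} : LTDvd A N ξ η ↔ val A N η ≤ val A N ξ := by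
  constructor
  · rintro ⟨x, y, rfl, rfl, h⟩
    rwa [val_rv, val_rv]
  · intro h
    obtain ⟨x, rfl⟩ := rv_surjective N ξ
    obtain ⟨y, rfl⟩ := rv_surjective N η
    rw [val_rv, val_rv] at h
    exact ⟨x, y, rfl, rfl, h⟩

/-- For `z` above `ξ'` and `γ` the largest value of a term of `g` at `z`, the last clause of the
predicate gives `|g z| < γ |N|²` and the derivative clause gives `γ |N| ≤ |z g' z|`. Newton's lemma
for `g(zX)` at `1` then moves `z` by a relative amount smaller than `|N|`, which `rv_N` does not
see. -/
theorem exists_root_of_henselLift [CharZero K] (hA : HenselianLocalRing A) {N : ℕ+} {d : ℕ}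
    {ξ : LT A N} (g : K[X]) (hg : g.natDegree ≤ d)
    (h : HenselLift A N d ξ (fun i => rv A (N ^ 2) (g.coeff i))) :
    ∃ z, rv A N z = ξ ∧ g.eval z = 0 := by
  obtain ⟨a, ha, ⟨i₁, hi₁⟩, hξ, hder, ξ', hξ', x, hx, hx0⟩ := h
  rw [rv_eq_zero] at hx0
  obtain ⟨z, rfl⟩ := rv_surjective _ ξ'
  rw [proj_rv] at hξ'
  have hz : z ≠ 0 := by
    rintro rfl
    exact hξ (by rw [← hξ', rv_zero])
  have hav : ∀ i, A.valuation (a i) = A.valuation (g.coeff i) := fun i =>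
    valuation_eq_of_rv_eq (ha i)
  set p := g.comp (C z * X) with hp
  have hpc : ∀ k, p.coeff k = g.coeff k * z ^ k := fun k => comp_C_mul_X_coeff
  have hpd : p.natDegree ≤ d := by
    refine natDegree_le_iff_coeff_eq_zero.2 fun k hk => ?_
    rw [hpc, coeff_eq_zero_of_natDegree_lt (by omega), zero_mul]
  obtain ⟨i₀, -, hi₀⟩ := Finset.exists_max_image (Finset.univ : Finset (Fin (d + 1)))
    (fun i => A.valuation (p.coeff i)) ⟨0, Finset.mem_univ _⟩
  set γ := A.valuation (p.coeff i₀) with hγ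
  have hle : ∀ k, A.valuation (p.coeff k) ≤ γ := by
    intro k
    by_cases hk : k < d + 1
    · exact hi₀ ⟨k, hk⟩ (Finset.mem_univ _)
    · rw [coeff_eq_zero_of_natDegree_lt (by omega), map_zero]
      exact zero_le
  have hγ0 : 0 < γ := by
    refine lt_of_lt_of_le ?_ (hle i₁)
    rw [hpc, map_mul, ← hav, map_pow]
    refine mul_pos (zero_lt_iff.2 (by simpa using hi₁)) (pow_pos (zero_lt_iff.2 ?_) _)
    simpa using hz
  set κ := A.valuation ((N : ℕ) : K) with hκ
  have hκ1 : κ ≤ 1 := valuation_natCast_le_one A _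
  have hlt : A.valuation (p.eval 1) < γ * κ ^ 2 := by
    -- The `xᵢ` sum to zero and agree with the terms of `p` at level `N²`, so `p.eval 1` is a sum of
    -- differences smaller than `γ κ²`.
    have hpos : 0 < γ * κ ^ 2 := mul_pos hγ0 (pow_pos (valuation_pnat_pos N) _)
    have e : p.eval 1 = ∑ i : Fin (d + 1), (p.coeff i - x i) := by
      rw [Finset.sum_sub_distrib, hx0, sub_zero, eval_one_eq_sum p hpd]
    rw [e]
    refine A.valuation.map_sum_lt' hpos fun i _ => ?_
    have hi : rv A (N ^ 2) (p.coeff i) = rv A (N ^ 2) (x i) := by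
      rw [hx i, hpc, rv_mul, rv_pow]
      simp only [ha i]
    rcases rv_eq_iff.1 hi with h | h
    · rwa [h, sub_self, map_zero]
    · rw [Valuation.map_sub_swap]
      refine h.trans_le ?_
      rw [PNat.pow_coe, Nat.cast_pow, map_pow, mul_comm]
      gcongr
      exact hle i
  obtain ⟨i, hi⟩ := exists_succ_of_sum_lt (fun i : Fin (d + 1) => p.coeff i) hγ0 ⟨i₀, le_rfl⟩ (by
    rw [← eval_one_eq_sum p hpd]
    exact hlt.trans_le (mul_le_of_le_one_right' (pow_le_one' hκ1 2)))
  have hgd : g.derivative.eval z =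
      ∑ i : Fin d, (((i : ℕ) + 1 : ℕ) : K) * g.coeff (i + 1) * z ^ (i : ℕ) := by
    rcases d with _ | d
    · exact i.elim0
    rw [eval_eq_sum_range' (n := d + 1)
      (lt_of_le_of_lt (natDegree_derivative_le g) (by omega)), ← Fin.sum_univ_eq_sum_range
        (fun i => g.derivative.coeff i * z ^ i)]
    refine Finset.sum_congr rfl fun j _ => ?_
    rw [coeff_derivative]
    push_cast
    ring
  have hder' : γ * κ ≤ A.valuation (p.derivative.eval 1) := by
    have h1 := hder (rv A N (g.derivative.eval z))
      ⟨fun i => (((i : ℕ) + 1 : ℕ) : K) * g.coeff (i + 1) * z ^ (i : ℕ), fun i => by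
        dsimp only
        rw [rv_mul, rv_mul, rv_mul, rv_pow, hξ',
          rv_eq_of_dvd (dvd_pow_self N two_ne_zero) (ha i.succ), Fin.val_succ], by rw [hgd]⟩ i
    rw [val_rv, ← hξ', val_rv, hav] at h1
    have h2 : p.derivative.eval 1 = z * g.derivative.eval z := by
      rw [hp, derivative_comp]
      simp
    rw [h2, map_mul]
    refine le_trans ?_ (mul_le_mul_right h1 (A.valuation z))
    rw [hpc, map_mul, map_pow, Fin.val_succ, pow_succ] at hi
    rw [Fin.val_succ]
    calc γ * κ ≤ A.valuation (g.coeff (i + 1)) * (A.valuation z ^ (i : ℕ) * A.valuation z) * κ := by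
          gcongr
      _ = _ := by ac_rfl
  obtain ⟨t, ht, ht1⟩ := exists_root_near_one hA p γ hle (by
    calc A.valuation (p.eval 1) * γ < (γ * κ ^ 2) * γ := by gcongr
      _ = (γ * κ) ^ 2 := by rw [mul_pow, sq γ]; ac_rfl
      _ ≤ _ := by gcongr)
  -- If `κ ≤ |t - 1|`, the estimate `ht1` would give `κ (γ κ) ≤ |p 1|`.
  have hvt : A.valuation (t - 1) < κ := by
    by_contra! hcon
    have : γ * κ ^ 2 ≤ A.valuation (p.eval 1) := by
      refine le_trans ?_ ht1
      calc γ * κ ^ 2 = κ * (γ * κ) := by rw [sq]; ac_rfl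
        _ ≤ _ := by gcongr
    exact absurd hlt (not_lt.2 this)
  refine ⟨z * t, ?_, ?_⟩
  · rw [← hξ', eq_comm, rv_eq_iff]
    right
    have : z * t - z = (t - 1) * z := by ring
    rw [this, map_mul]
    gcongr
    exact zero_lt_iff.2 (by simpa using hz)
  · rw [hp, eval_comp] at ht
    simpa using ht

/-- By `hder` the terms of `g' z` cancel little, so all members of the sum in the derivative clause
have the order of `g' z`. The factor `d!` in `N` absorbs the integers `i` that multiply the
coefficients of `g'`. -/
theorem henselLift_of_root [CharZero K] {N N₀ : ℕ+} {d : ℕ} (g : K[X]) (hg : g.natDegree ≤ d)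
    (hg0 : g ≠ 0) {z : K} (hz : z ≠ 0) (hroot : g.eval z = 0)
    (hN : N₀ * ⟨d.factorial, Nat.factorial_pos _⟩ ∣ N)
    (hder : ∀ j, A.valuation (g.derivative.coeff j) * A.valuation z ^ j *
      A.valuation ((N₀ : ℕ) : K) ≤ A.valuation (g.derivative.eval z)) :
    HenselLift A N d (rv A N z) (fun i => rv A (N ^ 2) (g.coeff i)) := by
  refine ⟨fun i => g.coeff i, fun i => rfl, ?_, by rwa [ne_eq, rv_eq_zero], ?_, rv A (N ^ 2) z,
    proj_rv _ _ _, fun i => g.coeff i * z ^ (i : ℕ), fun i => by rw [rv_mul, rv_pow], ?_⟩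
  · by_contra! hcon
    refine hg0 (ext fun k => ?_)
    by_cases hk : k < d + 1
    · simpa using hcon ⟨k, hk⟩
    · rw [coeff_eq_zero_of_natDegree_lt (by omega), coeff_zero]
  · rintro η ⟨x, hx, rfl⟩ i
    rcases d with _ | d
    · exact i.elim0
    set y : Fin (d + 1) → K := fun i => g.derivative.coeff i * z ^ (i : ℕ) with hy
    have hgd : g.derivative.eval z = ∑ i, y i := by
      rw [eval_eq_sum_range' (n := d + 1)
        (lt_of_le_of_lt (natDegree_derivative_le g) (by omega)), ← Fin.sum_univ_eq_sum_range
          (fun i => g.derivative.coeff i * z ^ i)]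
    have hxy : ∀ i, rv A N (y i) = rv A N (x i) := by
      intro i
      rw [hx i, hy]
      dsimp only
      rw [rv_mul, rv_pow, coeff_derivative, Fin.val_succ, mul_comm (g.coeff _)]
      push_cast
      rfl
    -- Only the order of the sum is needed, so agreement at level `1` suffices.
    have h1 := rv_sum_congr (N := 1) (N₀ := N₀) (M := N)
      (by rw [one_mul]; exact (dvd_mul_right _ _).trans hN) hxy (fun i => by
        rw [← hgd, hy, map_mul, map_pow]
        exact hder i)
    rw [val_rv, val_rv, ← valuation_eq_of_rv_eq h1, ← hgd]
    refine le_trans ?_ (hder i)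
    have h2 : A.valuation ((N : ℕ) : K) ≤
        A.valuation (((i : ℕ) + 1 : ℕ) : K) * A.valuation ((N₀ : ℕ) : K) := by
      rw [← map_mul, ← Nat.cast_mul]
      refine valuation_natCast_le_of_dvd ?_
      have : (d + 1).factorial * (N₀ : ℕ) ∣ N := by
        rw [mul_comm]
        exact PNat.dvd_iff.1 hN
      exact (mul_dvd_mul_right (Nat.dvd_factorial (by omega) (by omega)) _).trans this
    rw [coeff_derivative, map_mul]
    calc A.valuation (g.coeff (i + 1)) * A.valuation z ^ (i : ℕ) * A.valuation ((N : ℕ) : K)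
        ≤ A.valuation (g.coeff (i + 1)) * A.valuation z ^ (i : ℕ) *
          (A.valuation (((i : ℕ) + 1 : ℕ) : K) * A.valuation ((N₀ : ℕ) : K)) := by gcongr
      _ = _ := by push_cast; ac_rfl
  · rw [rv_eq_zero, ← hroot, eval_eq_sum_range' (Nat.lt_succ_of_le hg),
      Fin.sum_univ_eq_sum_range (fun i => g.coeff i * z ^ i)]

end LeadingTerm

/-! ### Uniform definability in families of many-sorted structures -/

namespace ManySorted

variable {S : Type} {L : Signature.{u} S}

theorem Tuple.cons_head_tail {X : S → Type w} {s : S} {Γ : List S} (v : Tuple X (s :: Γ)) :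
    Tuple.cons (v s .zero) (fun t x => v t (.succ x)) = v := by
  funext t x
  cases x <;> rfl

theorem Tuple.eq_nil {X : S → Type w} (v : Tuple X []) : v = Tuple.nil := by
  funext t x
  cases x

/-! ### Substitution -/

/-- Substitution of terms for the variables of a term. -/
def Term.subst {Γ Δ : List S} (σ : ∀ s, Var Γ s → Term L Δ s) : {s : S} → Term L Γ s → Term L Δ s
  | _, .var x => σ _ x
  | _, .app f ts => .app f (fun i => (ts i).subst σ)

theorem Term.eval_subst (M : Struct.{u, w} L) {Γ Δ : List S} (σ : ∀ s, Var Γ s → Term L Δ s)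
    (v : Tuple M.carrier Δ) {s : S} (t : Term L Γ s) :
    (t.subst σ).eval M v = t.eval M (fun s x => (σ s x).eval M v) := by
  induction t with
  | var x => rfl
  | app f ts ih => simp only [Term.subst, Term.eval, ih]

/-- The extension of a substitution to one more variable. -/
def liftSubst {Γ Δ : List S} (σ : ∀ s, Var Γ s → Term L Δ s) (s : S) :
    ∀ t, Var (s :: Γ) t → Term L (s :: Δ) t
  | _, .zero => .var .zero
  | _, .succ x => (σ _ x).subst (fun _ y => .var y.succ)

theorem eval_liftSubst (M : Struct.{u, w} L) {Γ Δ : List S} (σ : ∀ s, Var Γ s → Term L Δ s) (s : S)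
    (a : M.carrier s) (v : Tuple M.carrier Δ) :
    (fun t x => (liftSubst σ s t x).eval M (Tuple.cons a v)) =
      Tuple.cons a (fun t x => (σ t x).eval M v) := by
  funext t x
  cases x with
  | zero => rfl
  | succ x => exact Term.eval_subst M _ _ _

/-- Substitution of terms for the free variables of a formula. -/
def Formula.subst : {Γ Δ : List S} → (∀ s, Var Γ s → Term L Δ s) → Formula L Γ → Formula L Δ
  | _, _, _, .falsum => .falsum
  | _, _, σ, .eq t₁ t₂ => .eq (t₁.subst σ) (t₂.subst σ)
  | _, _, σ, .rel r ts => .rel r (fun i => (ts i).subst σ)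
  | _, _, σ, .not φ => .not (φ.subst σ)
  | _, _, σ, .and φ ψ => .and (φ.subst σ) (ψ.subst σ)
  | _, _, σ, .or φ ψ => .or (φ.subst σ) (ψ.subst σ)
  | _, _, σ, .all s φ => .all s (φ.subst (liftSubst σ s))
  | _, _, σ, .ex s φ => .ex s (φ.subst (liftSubst σ s))

theorem Formula.holds_subst (M : Struct.{u, w} L) {Γ : List S} (φ : Formula L Γ) :
    ∀ {Δ : List S} (σ : ∀ s, Var Γ s → Term L Δ s) (v : Tuple M.carrier Δ),
      (φ.subst σ).Holds M v ↔ φ.Holds M (fun s x => (σ s x).eval M v) := by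
  induction φ with
  | falsum => intros; rfl
  | eq t₁ t₂ => intros; simp only [subst, Holds, Term.eval_subst]
  | rel r ts => intros; simp only [subst, Holds, Term.eval_subst]
  | not φ ih => intros; simp only [subst, Holds, ih]
  | and φ ψ ih₁ ih₂ => intros; simp only [subst, Holds, ih₁, ih₂]
  | or φ ψ ih₁ ih₂ => intros; simp only [subst, Holds, ih₁, ih₂]
  | all s φ ih => intros; simp only [subst, Holds, ih, eval_liftSubst]
  | ex s φ ih => intros; simp only [subst, Holds, ih, eval_liftSubst]

theorem Formula.IsQF.subst {Γ : List S} {φ : Formula L Γ} (h : φ.IsQF) {Δ : List S}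
    (σ : ∀ s, Var Γ s → Term L Δ s) : (φ.subst σ).IsQF := by
  induction φ generalizing Δ with
  | falsum => trivial
  | eq t₁ t₂ => trivial
  | rel r ts => trivial
  | not φ ih => exact ih h σ
  | and φ ψ ih₁ ih₂ => exact ⟨ih₁ h.1 σ, ih₂ h.2 σ⟩
  | or φ ψ ih₁ ih₂ => exact ⟨ih₁ h.1 σ, ih₂ h.2 σ⟩
  | all s φ => exact h.elim
  | ex s φ => exact h.elim

theorem Formula.IsExistentialOver.subst {Q : S → Prop} {Γ : List S} {φ : Formula L Γ}
    (h : φ.IsExistentialOver Q) : ∀ {Δ : List S} (σ : ∀ s, Var Γ s → Term L Δ s),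
      (φ.subst σ).IsExistentialOver Q := by
  induction h with
  | qf h => exact fun σ => .qf (h.subst σ)
  | ex hs _ ih => exact fun σ => .ex hs (ih _)

theorem Formula.holds_weaken (M : Struct.{u, w} L) {Γ : List S} (φ : Formula L Γ) {s : S}
    (a : M.carrier s) (v : Tuple M.carrier Γ) :
    (φ.subst (fun _ y => Term.var (Var.succ (t := s) y))).Holds M (Tuple.cons a v) ↔
      φ.Holds M v :=
  Formula.holds_subst M φ _ _

theorem Formula.IsExistentialOver.exists_and {Q : S → Prop} {Γ : List S} {φ ψ : Formula L Γ}
    (hφ : φ.IsExistentialOver Q) (hψ : ψ.IsExistentialOver Q) :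
    ∃ χ : Formula L Γ, χ.IsExistentialOver Q ∧
      ∀ (M : Struct.{u, w} L) v, χ.Holds M v ↔ φ.Holds M v ∧ ψ.Holds M v := by
  induction hφ with
  | @qf Γ φ h =>
    induction hψ with
    | @qf Γ ψ h' => exact ⟨.and φ ψ, .qf ⟨h, h'⟩, fun M v => Iff.rfl⟩
    | @ex Γ s ψ hs _ ih =>
      obtain ⟨χ, h₁, h₂⟩ := ih (h.subst (fun _ y => .var y.succ))
      refine ⟨.ex s χ, .ex hs h₁, fun M v => ?_⟩
      simp only [Holds, h₂, holds_weaken, exists_and_left]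
  | @ex Γ s φ hs _ ih =>
    obtain ⟨χ, h₁, h₂⟩ := ih (hψ.subst (fun _ y => .var y.succ))
    refine ⟨.ex s χ, .ex hs h₁, fun M v => ?_⟩
    simp only [Holds, h₂, holds_weaken, exists_and_right]

/-- A quantifier moves out of a disjunction only over a nonempty sort, and carriers of structures
may be empty. -/
theorem Formula.IsExistentialOver.exists_or {Q : S → Prop} {Γ : List S} {φ ψ : Formula L Γ}
    (hφ : φ.IsExistentialOver Q) (hψ : ψ.IsExistentialOver Q) :
    ∃ χ : Formula L Γ, χ.IsExistentialOver Q ∧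
      ∀ (M : Struct.{u, w} L), (∀ s, Q s → Nonempty (M.carrier s)) →
        ∀ v, χ.Holds M v ↔ φ.Holds M v ∨ ψ.Holds M v := by
  induction hφ with
  | @qf Γ φ h =>
    induction hψ with
    | @qf Γ ψ h' => exact ⟨.or φ ψ, .qf ⟨h, h'⟩, fun M _ v => Iff.rfl⟩
    | @ex Γ s ψ hs _ ih =>
      obtain ⟨χ, h₁, h₂⟩ := ih (h.subst (fun _ y => .var y.succ))
      refine ⟨.ex s χ, .ex hs h₁, fun M hM v => ?_⟩
      have := hM s hs
      simp only [Holds, h₂ M hM, holds_weaken, _root_.exists_or, exists_const]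
  | @ex Γ s φ hs _ ih =>
    obtain ⟨χ, h₁, h₂⟩ := ih (hψ.subst (fun _ y => .var y.succ))
    refine ⟨.ex s χ, .ex hs h₁, fun M hM v => ?_⟩
    have := hM s hs
    simp only [Holds, h₂ M hM, holds_weaken, _root_.exists_or, exists_const]

/-! ### Blocks of variables of one sort -/

/-- The tuple `(ζ₀, …, ζₘ₋₁, v)`. -/
def Tuple.vcons {X : S → Type w} {s : S} {Γ : List S} :
    {m : ℕ} → (Fin m → X s) → Tuple X Γ → Tuple X (List.replicate m s ++ Γ)
  | 0, _, v => v
  | _ + 1, ζ, v => Tuple.cons (ζ 0) (Tuple.vcons (fun i => ζ i.succ) v)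

/-- The variables of a block. -/
def Var.block {s : S} {Γ : List S} : {m : ℕ} → Fin m → Var (List.replicate m s ++ Γ) s
  | _ + 1, k => Fin.cases .zero (fun j => .succ (Var.block j)) k

/-- The variables after a block. -/
def Var.rest {s : S} {Γ : List S} : {m : ℕ} → {t : S} → Var Γ t → Var (List.replicate m s ++ Γ) t
  | 0, _, y => y
  | _ + 1, _, y => .succ (Var.rest y)

theorem Tuple.vcons_block {X : S → Type w} {s : S} {Γ : List S} {m : ℕ} (ζ : Fin m → X s)
    (v : Tuple X Γ) (k : Fin m) : Tuple.vcons ζ v s (Var.block k) = ζ k := by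
  induction m with
  | zero => exact k.elim0
  | succ m ih => exact Fin.cases rfl (fun j => ih _ j) k

theorem Tuple.vcons_rest {X : S → Type w} {s : S} {Γ : List S} {m : ℕ} (ζ : Fin m → X s)
    (v : Tuple X Γ) {t : S} (y : Var Γ t) : Tuple.vcons ζ v t (Var.rest y) = v t y := by
  induction m with
  | zero => rfl
  | succ m ih => exact ih _

theorem Tuple.exists_eq_vcons {X : S → Type w} {s : S} {Γ : List S} {m : ℕ}
    (z : Tuple X (List.replicate m s ++ Γ)) : ∃ (ζ : Fin m → X s) (v : Tuple X Γ),
      z = Tuple.vcons ζ v := by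
  induction m with
  | zero => exact ⟨Fin.elim0, z, rfl⟩
  | succ m ih =>
    obtain ⟨ζ, v, h⟩ := ih (fun t x => z t (.succ x))
    refine ⟨Fin.cons (z s .zero) ζ, v, (Tuple.cons_head_tail (Γ := List.replicate m s ++ Γ) z).symm.trans ?_⟩
    rw [h]
    rfl

/-- Existential quantification over a block of variables. -/
def Formula.exs {s : S} {Γ : List S} :
    {m : ℕ} → Formula L (List.replicate m s ++ Γ) → Formula L Γ
  | 0, φ => φ
  | _ + 1, φ => Formula.exs (.ex s φ)

theorem Formula.holds_exs (M : Struct.{u, w} L) {s : S} {Γ : List S} {m : ℕ}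
    (φ : Formula L (List.replicate m s ++ Γ)) (v : Tuple M.carrier Γ) :
    φ.exs.Holds M v ↔ ∃ ζ : Fin m → M.carrier s, φ.Holds M (Tuple.vcons ζ v) := by
  induction m with
  | zero => exact ⟨fun h => ⟨Fin.elim0, h⟩, fun ⟨_, h⟩ => h⟩
  | succ m ih =>
    refine (ih (.ex s φ)).trans ⟨?_, ?_⟩
    · rintro ⟨ζ, a, h⟩
      exact ⟨Fin.cons a ζ, h⟩
    · rintro ⟨ζ, h⟩
      exact ⟨fun i => ζ i.succ, ζ 0, h⟩

theorem Formula.IsExistentialOver.exs {Q : S → Prop} {s : S} (hs : Q s) {Γ : List S} {m : ℕ}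
    {φ : Formula L (List.replicate m s ++ Γ)} (h : φ.IsExistentialOver Q) :
    φ.exs.IsExistentialOver Q := by
  induction m with
  | zero => exact h
  | succ m ih => exact ih (.ex hs h)

/-! ### Conjunctions and universal closures -/

/-- The conjunction of a finite family of formulas. -/
def Formula.conj {Γ : List S} : {n : ℕ} → (Fin n → Formula L Γ) → Formula L Γ
  | 0, _ => .not .falsum
  | _ + 1, φ => .and (φ 0) (Formula.conj fun k => φ k.succ)

theorem Formula.holds_conj (M : Struct.{u, w} L) {Γ : List S} {n : ℕ} (φ : Fin n → Formula L Γ)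
    (v : Tuple M.carrier Γ) : (Formula.conj φ).Holds M v ↔ ∀ k, (φ k).Holds M v := by
  induction n with
  | zero => simp [conj, Holds]
  | succ n ih => rw [Fin.forall_fin_succ, ← ih fun k => φ k.succ]; rfl

/-- The universal closure of a formula. -/
def Formula.closure : {Γ : List S} → Formula L Γ → Sentence L
  | [], φ => φ
  | s :: _, φ => Formula.closure (.all s φ)

theorem Formula.holds_closure (M : Struct.{u, w} L) {Γ : List S} (φ : Formula L Γ) :
    φ.closure.Holds M Tuple.nil ↔ ∀ v, φ.Holds M v := by
  induction Γ with
  | nil => exact ⟨fun h v => by rwa [Tuple.eq_nil v], fun h => h _⟩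
  | cons s Γ ih =>
    refine (ih (.all s φ)).trans ⟨fun h v => ?_, fun h v a => h _⟩
    rw [← Tuple.cons_head_tail v]
    exact h _ _

/-- Logical equivalence of two formulas, as a formula. -/
def Formula.iff {Γ : List S} (φ ψ : Formula L Γ) : Formula L Γ :=
  .and (.or (.not φ) ψ) (.or (.not ψ) φ)

theorem Formula.holds_iff (M : Struct.{u, w} L) {Γ : List S} (φ ψ : Formula L Γ)
    (v : Tuple M.carrier Γ) : (φ.iff ψ).Holds M v ↔ (φ.Holds M v ↔ ψ.Holds M v) := by
  simp only [Formula.iff, Holds]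
  tauto

/-! ### Definable functions and predicates on families of structures -/

variable {ι : Type*} {𝔐 : ι → Struct.{u, w} L}

/-- A way to view the elements of `W i` as tuples in the structure `𝔐 i`. -/
structure Env (𝔐 : ι → Struct.{u, w} L) (W : ι → Type*) where
  /-- the sorts of the coordinates -/
  ctx : List S
  /-- the coordinates -/
  val : ∀ i, W i → Tuple (𝔐 i).carrier ctx

namespace Env

variable {W W' W'' : ι → Type*}

/-- Add one variable. -/
def ext (e : Env 𝔐 W) (s : S) : Env 𝔐 (fun i => W i × (𝔐 i).carrier s) where
  ctx := s :: e.ctx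
  val i p := Tuple.cons p.2 (e.val i p.1)

/-- Add a finite family of variables. -/
noncomputable def vec (e : Env 𝔐 W) (κ : Type) [Fintype κ] (s : S) :
    Env 𝔐 (fun i => W i × (κ → (𝔐 i).carrier s)) where
  ctx := List.replicate (Fintype.card κ) s ++ e.ctx
  val i p := Tuple.vcons (fun k => p.2 ((Fintype.equivFin κ).symm k)) (e.val i p.1)

/-- The functions given by a term. -/
def DF (e : Env 𝔐 W) {s : S} (f : ∀ i, W i → (𝔐 i).carrier s) : Prop :=
  ∃ t : Term L e.ctx s, ∀ i w, t.eval (𝔐 i) (e.val i w) = f i w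

/-- The predicates given by an existential formula with quantifiers over sorts in `Q`. -/
def ES (Q : S → Prop) (e : Env 𝔐 W) (X : ∀ i, W i → Prop) : Prop :=
  ∃ φ : Formula L e.ctx, φ.IsExistentialOver Q ∧ ∀ i w, φ.Holds (𝔐 i) (e.val i w) ↔ X i w

/-- The coordinates of `τ` are given by terms. -/
def Maps (e' : Env 𝔐 W') (e : Env 𝔐 W) (τ : ∀ i, W' i → W i) : Prop :=
  ∀ s (x : Var e.ctx s), e'.DF (fun i w => e.val i (τ i w) s x)

variable {Q : S → Prop} {e : Env 𝔐 W} {e' : Env 𝔐 W'}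

/-- Substitution as a change of coordinates. With `ES.comp` it carries the bookkeeping of variables;
one term or formula always serves all the structures `𝔐 i`. -/
theorem DF.comp {s : S} {f : ∀ i, W i → (𝔐 i).carrier s} (hf : e.DF f) {τ : ∀ i, W' i → W i}
    (hτ : e'.Maps e τ) : e'.DF (fun i w => f i (τ i w)) := by
  choose σ hσ using hτ
  obtain ⟨t, ht⟩ := hf
  refine ⟨t.subst σ, fun i w => ?_⟩
  simp only [Term.eval_subst, hσ]
  exact ht i (τ i w)

theorem ES.comp {X : ∀ i, W i → Prop} (hX : e.ES Q X) {τ : ∀ i, W' i → W i}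
    (hτ : e'.Maps e τ) : e'.ES Q (fun i w => X i (τ i w)) := by
  choose σ hσ using hτ
  obtain ⟨φ, h, hφ⟩ := hX
  refine ⟨φ.subst σ, h.subst σ, fun i w => ?_⟩
  simp only [Formula.holds_subst, hσ]
  exact hφ i (τ i w)

theorem maps_id : e.Maps e (fun _ w => w) := fun _ x => ⟨.var x, fun _ _ => rfl⟩

theorem maps_ext (s : S) : (e.ext s).Maps e (fun _ p => p.1) :=
  fun _ x => ⟨.var x.succ, fun _ _ => rfl⟩

theorem DF.last (s : S) : (e.ext s).DF (s := s) (fun _ p => p.2) := ⟨.var .zero, fun _ _ => rfl⟩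

theorem DF.vcons {m : ℕ} {s : S} {f : Fin m → ∀ i, W' i → (𝔐 i).carrier s}
    (hf : ∀ k, e'.DF (f k)) {τ : ∀ i, W' i → W i} (hτ : e'.Maps e τ) :
    ∀ t (x : Var (List.replicate m s ++ e.ctx) t),
      e'.DF (fun i w => Tuple.vcons (fun k => f k i w) (e.val i (τ i w)) t x) := by
  induction m with
  | zero => exact hτ
  | succ m ih =>
    intro t x
    change Var (s :: (List.replicate m s ++ e.ctx)) t at x
    cases x with
    | zero => exact hf 0
    | succ x => exact ih (fun k => hf k.succ) t x

theorem Maps.vec {κ : Type} [Fintype κ] {s : S} {f : κ → ∀ i, W' i → (𝔐 i).carrier s}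
    (hf : ∀ k, e'.DF (f k)) {τ : ∀ i, W' i → W i} (hτ : e'.Maps e τ) :
    e'.Maps (e.vec κ s) (fun i w => (τ i w, fun k => f k i w)) :=
  DF.vcons (fun _ => hf _) hτ

theorem DF.coord {κ : Type} [Fintype κ] (s : S) (k : κ) :
    (e.vec κ s).DF (s := s) (fun _ p => p.2 k) := by
  refine ⟨.var (Var.block (Fintype.equivFin κ k)), fun i p => (Tuple.vcons_block _ _ _).trans ?_⟩
  rw [Equiv.symm_apply_apply]

theorem maps_vec (κ : Type) [Fintype κ] (s : S) : (e.vec κ s).Maps e (fun _ p => p.1) :=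
  fun _ y => ⟨.var (Var.rest y), fun _ _ => Tuple.vcons_rest _ _ _⟩

theorem Maps.comp {e'' : Env 𝔐 W''} {τ : ∀ i, W' i → W i} {τ' : ∀ i, W'' i → W' i}
    (hτ : e'.Maps e τ) (hτ' : e''.Maps e' τ') : e''.Maps e (fun i w => τ i (τ' i w)) :=
  fun s x => (hτ s x).comp hτ'

/-- The restriction of an environment along a map. -/
def pull (e : Env 𝔐 W) (τ : ∀ i, W' i → W i) : Env 𝔐 W' where
  ctx := e.ctx
  val i w := e.val i (τ i w)

theorem maps_pull (e : Env 𝔐 W) (τ : ∀ i, W' i → W i) : (e.pull τ).Maps e τ :=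
  fun _ x => ⟨.var x, fun _ _ => rfl⟩

theorem DF.app (f : L.Func) {g : ∀ j : Fin (L.arity f), ∀ i, W i → (𝔐 i).carrier (L.dom f j)}
    (hg : ∀ j, e.DF (g j)) : e.DF (fun i w => (𝔐 i).func f (fun j => g j i w)) := by
  choose ts hts using hg
  refine ⟨.app f ts, fun i w => ?_⟩
  simp only [Term.eval, hts]

theorem ES.rel (r : L.Rel) {g : ∀ j : Fin (L.relArity r), ∀ i, W i → (𝔐 i).carrier (L.relDom r j)}
    (hg : ∀ j, e.DF (g j)) : e.ES Q (fun i w => (𝔐 i).rel r (fun j => g j i w)) := by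
  choose ts hts using hg
  refine ⟨.rel r ts, .qf trivial, fun i w => ?_⟩
  simp only [Formula.Holds, hts]

theorem ES.eq {s : S} {f g : ∀ i, W i → (𝔐 i).carrier s} (hf : e.DF f) (hg : e.DF g) :
    e.ES Q (fun i w => f i w = g i w) := by
  obtain ⟨t, ht⟩ := hf
  obtain ⟨t', ht'⟩ := hg
  refine ⟨.eq t t', .qf trivial, fun i w => ?_⟩
  simp only [Formula.Holds, ht, ht']

theorem ES.ne {s : S} {f g : ∀ i, W i → (𝔐 i).carrier s} (hf : e.DF f) (hg : e.DF g) :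
    e.ES Q (fun i w => f i w ≠ g i w) := by
  obtain ⟨t, ht⟩ := hf
  obtain ⟨t', ht'⟩ := hg
  refine ⟨.not (.eq t t'), .qf trivial, fun i w => ?_⟩
  simp only [Formula.Holds, ht, ht', ne_eq]

/-- With no sort allowed in quantifiers, `ES` means quantifier-free definability, which is closed
under negation. -/
theorem ES.not {X : ∀ i, W i → Prop} (hX : e.ES (fun _ => False) X) :
    e.ES (fun _ => False) (fun i w => ¬ X i w) := by
  obtain ⟨φ, h, hφ⟩ := hX
  cases h with
  | qf h => exact ⟨.not φ, .qf h, fun i w => not_congr (hφ i w)⟩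
  | ex hs _ => exact hs.elim

theorem ES.of_false {X : ∀ i, W i → Prop} (hX : e.ES (fun _ => False) X) : e.ES Q X := by
  obtain ⟨φ, h, hφ⟩ := hX
  cases h with
  | qf h => exact ⟨φ, .qf h, hφ⟩
  | ex hs _ => exact hs.elim

theorem ES.false : e.ES Q (fun _ _ => False) := ⟨.falsum, .qf trivial, fun _ _ => Iff.rfl⟩

theorem ES.true : e.ES Q (fun _ _ => True) :=
  ⟨.not .falsum, .qf trivial, fun _ _ => by simp [Formula.Holds]⟩

theorem ES.congr {X Y : ∀ i, W i → Prop} (hX : e.ES Q X) (h : ∀ i w, Y i w ↔ X i w) :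
    e.ES Q Y := by
  obtain ⟨φ, h₁, h₂⟩ := hX
  exact ⟨φ, h₁, fun i w => (h₂ i w).trans (h i w).symm⟩

theorem ES.and {X Y : ∀ i, W i → Prop} (hX : e.ES Q X) (hY : e.ES Q Y) :
    e.ES Q (fun i w => X i w ∧ Y i w) := by
  obtain ⟨φ, h₁, h₂⟩ := hX
  obtain ⟨ψ, h₃, h₄⟩ := hY
  obtain ⟨χ, h₅, h₆⟩ := h₁.exists_and h₃
  refine ⟨χ, h₅, fun i w => ?_⟩
  rw [h₆, h₂, h₄]

theorem ES.or (hQ : ∀ i s, Q s → Nonempty ((𝔐 i).carrier s)) {X Y : ∀ i, W i → Prop}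
    (hX : e.ES Q X) (hY : e.ES Q Y) : e.ES Q (fun i w => X i w ∨ Y i w) := by
  obtain ⟨φ, h₁, h₂⟩ := hX
  obtain ⟨ψ, h₃, h₄⟩ := hY
  obtain ⟨χ, h₅, h₆⟩ := h₁.exists_or h₃
  refine ⟨χ, h₅, fun i w => ?_⟩
  rw [h₆ _ (hQ i), h₂, h₄]

theorem ES.ex {s : S} (hs : Q s) {X : ∀ i, W i → (𝔐 i).carrier s → Prop}
    (hX : (e.ext s).ES Q (fun i p => X i p.1 p.2)) : e.ES Q (fun i w => ∃ a, X i w a) := by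
  obtain ⟨φ, h₁, h₂⟩ := hX
  exact ⟨.ex s φ, .ex hs h₁, fun i w => exists_congr fun a => h₂ i (w, a)⟩

theorem ES.exVec {κ : Type} [Fintype κ] {s : S} (hs : Q s)
    {X : ∀ i, W i → (κ → (𝔐 i).carrier s) → Prop}
    (hX : (e.vec κ s).ES Q (fun i p => X i p.1 p.2)) : e.ES Q (fun i w => ∃ ζ, X i w ζ) := by
  obtain ⟨φ, h₁, h₂⟩ := hX
  refine ⟨φ.exs, h₁.exs hs, fun i w => (Formula.holds_exs _ _ _).trans ⟨?_, ?_⟩⟩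
  · rintro ⟨ζ, h⟩
    refine ⟨fun k => ζ (Fintype.equivFin κ k), (h₂ i (w, _)).1 ?_⟩
    simpa [vec] using h
  · rintro ⟨ζ, h⟩
    exact ⟨_, (h₂ i (w, ζ)).2 h⟩

theorem ES.all_finite {κ : Type*} [Finite κ] {X : κ → ∀ i, W i → Prop}
    (hX : ∀ k, e.ES Q (X k)) : e.ES Q (fun i w => ∀ k, X k i w) := by
  classical
  have := Fintype.ofFinite κ
  suffices h : ∀ s : Finset κ, e.ES Q (fun i w => ∀ k ∈ s, X k i w) from
    (h Finset.univ).congr fun i w => by simp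
  intro s
  induction s using Finset.induction_on with
  | empty => exact ES.true.congr fun i w => by simp
  | insert a s _ ih => exact ((hX a).and ih).congr fun i w => by simp

theorem ES.ex_finite (hQ : ∀ i s, Q s → Nonempty ((𝔐 i).carrier s)) {κ : Type*} [Finite κ]
    {X : κ → ∀ i, W i → Prop} (hX : ∀ k, e.ES Q (X k)) : e.ES Q (fun i w => ∃ k, X k i w) := by
  classical
  have := Fintype.ofFinite κ
  suffices h : ∀ s : Finset κ, e.ES Q (fun i w => ∃ k ∈ s, X k i w) from
    (h Finset.univ).congr fun i w => by simp
  intro s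
  induction s using Finset.induction_on with
  | empty => exact ES.false.congr fun i w => by simp
  | insert a s _ ih => exact ((hX a).or hQ ih).congr fun i w => by simp

end Env

end ManySorted

/-! ### Definability in natural structures -/

namespace LeadingTerm

open ManySorted ManySorted.Env

/-- A nontrivially valued Henselian field of characteristic zero. -/
structure HVField where
  /-- the field -/
  K : Type v
  [field : Field K]
  [charZero : CharZero K]
  /-- the valuation ring -/
  A : ValuationSubring K
  ne_top : A ≠ ⊤
  henselian : HenselianLocalRing A

attribute [instance] HVField.field HVField.charZero

/-- The natural structure on a Henselian field. -/
noncomputable abbrev HVField.str (i : HVField.{v}) : Struct.{0, v} LRV := naturalStruct i.A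

theorem HVField.nonempty_carrier (i : HVField.{v}) (s : Srt) (_ : s ≠ Srt.VF) :
    Nonempty (i.str.carrier s) := by
  cases s with
  | VF => exact ⟨(0 : i.K)⟩
  | RV N => exact ⟨(0 : LT i.A N)⟩

variable {W : HVField.{v} → Type v} {e : Env HVField.str W} {N M : ℕ+}

/-- Definability by `∃`-simple formulas in the natural structures. -/
abbrev ESimple (e : Env HVField.str W) (X : ∀ i, W i → Prop) : Prop :=
  e.ES (fun s => s ≠ Srt.VF) X

/-- The valued field valued functions given by a term. -/
abbrev DFVF (e : Env HVField.str W) (f : ∀ i : HVField.{v}, W i → i.K) : Prop :=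
  e.DF (s := Srt.VF) f

/-- The functions with values in `RV_N` given by a term. -/
abbrev DFRV (e : Env HVField.str W) (N : ℕ+) (f : ∀ i : HVField.{v}, W i → LT i.A N) : Prop :=
  e.DF (s := Srt.RV N) f

theorem DFVF.zero : DFVF e (fun _ _ => 0) :=
  DF.app (L := LRV) (e := e) LRVFunc.zero (g := fun j => j.elim0) (fun j => j.elim0)

theorem DFVF.one : DFVF e (fun _ _ => 1) :=
  DF.app (L := LRV) (e := e) LRVFunc.one (g := fun j => j.elim0) (fun j => j.elim0)

theorem DFVF.add {f g : ∀ i : HVField.{v}, W i → i.K} (hf : DFVF e f) (hg : DFVF e g) :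
    DFVF e (fun i w => f i w + g i w) :=
  DF.app (L := LRV) (e := e) LRVFunc.add (g := fun j : Fin 2 => ![f, g] j) (Fin.forall_fin_two.2 ⟨hf, hg⟩)

theorem DFVF.mul {f g : ∀ i : HVField.{v}, W i → i.K} (hf : DFVF e f) (hg : DFVF e g) :
    DFVF e (fun i w => f i w * g i w) :=
  DF.app (L := LRV) (e := e) LRVFunc.mul (g := fun j : Fin 2 => ![f, g] j) (Fin.forall_fin_two.2 ⟨hf, hg⟩)

theorem DFVF.neg {f : ∀ i : HVField.{v}, W i → i.K} (hf : DFVF e f) :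
    DFVF e (fun i w => -f i w) :=
  DF.app (L := LRV) (e := e) LRVFunc.neg (g := fun _ : Fin 1 => f) (fun _ => hf)

theorem DFVF.rv (N : ℕ+) {f : ∀ i : HVField.{v}, W i → i.K} (hf : DFVF e f) :
    DFRV e N (fun i w => rv i.A N (f i w)) :=
  DF.app (L := LRV) (e := e) (LRVFunc.rv N) (g := fun _ : Fin 1 => f) (fun _ => hf)

theorem DFRV.zero : DFRV e N (fun _ _ => 0) :=
  DF.app (L := LRV) (e := e) (LRVFunc.zeroRV N) (g := fun j => j.elim0) (fun j => j.elim0)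

theorem DFRV.mul {f g : ∀ i : HVField.{v}, W i → LT i.A N} (hf : DFRV e N f) (hg : DFRV e N g) :
    DFRV e N (fun i w => f i w * g i w) :=
  DF.app (L := LRV) (e := e) (LRVFunc.mulRV N) (g := fun j : Fin 2 => ![f, g] j)
    (Fin.forall_fin_two.2 ⟨hf, hg⟩)

theorem DFRV.pow {f : ∀ i : HVField.{v}, W i → LT i.A N} (hf : DFRV e N f) (n : ℕ) :
    DFRV e N (fun i w => f i w ^ n) := by
  induction n with
  | zero =>
    have := DFVF.rv N (DFVF.one (e := e))
    simpa only [rv_one, pow_zero] using this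
  | succ n ih => simpa only [pow_succ] using ih.mul hf

theorem DFRV.proj (h : N ∣ M) {f : ∀ i : HVField.{v}, W i → LT i.A M} (hf : DFRV e M f) :
    DFRV e N (fun i w => proj i.A h (f i w)) :=
  DF.app (L := LRV) (e := e) (LRVFunc.proj N M h) (g := fun _ : Fin 1 => f) (fun _ => hf)

theorem ESimple.ltDvd {f g : ∀ i : HVField.{v}, W i → LT i.A N} (hf : DFRV e N f)
    (hg : DFRV e N g) : ESimple e (fun i w => LTDvd i.A N (f i w) (g i w)) :=
  ES.rel (L := LRV) (e := e) (LRVRel.dvd N) (g := fun j : Fin 2 => ![f, g] j)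
    (Fin.forall_fin_two.2 ⟨hf, hg⟩)

theorem ESimple.oplus {f g h : ∀ i : HVField.{v}, W i → LT i.A N} (hf : DFRV e N f)
    (hg : DFRV e N g) (hh : DFRV e N h) :
    ESimple e (fun i w => Oplus i.A N (f i w) (g i w) (h i w)) :=
  ES.rel (L := LRV) (e := e) (LRVRel.oplus N) (g := fun j : Fin 3 => ![f, g, h] j) 
    (Fin.cases hf (Fin.cases hg (Fin.cases hh (fun j => j.elim0))))

theorem ESimple.henselLift {d : ℕ} {f : ∀ i : HVField.{v}, W i → LT i.A N} (hf : DFRV e N f)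
    {g : Fin (d + 2) → ∀ i : HVField.{v}, W i → LT i.A (N ^ 2)}
    (hg : ∀ k, DFRV e (N ^ 2) (g k)) :
    ESimple e (fun i w => HenselLift i.A N (d + 1) (f i w) (fun k => g k i w)) := by
  have := ES.rel (L := LRV) (e := e) (Q := fun s => s ≠ Srt.VF) (LRVRel.P N ⟨d + 1, d.succ_pos⟩)
    (g := Fin.cases (motive := fun j => ∀ i : HVField.{v}, W i → i.str.carrier
      (LRVRel.dom (.P N ⟨d + 1, d.succ_pos⟩) j)) f g)
    (Fin.cases (motive := fun j => e.DF (Fin.cases (motive := fun j => ∀ i : HVField.{v}, W i →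
      i.str.carrier (LRVRel.dom (.P N ⟨d + 1, d.succ_pos⟩) j)) f g j)) hf hg)
  exact this

theorem ESimple.or {X Y : ∀ i, W i → Prop} (hX : ESimple e X) (hY : ESimple e Y) :
    ESimple e (fun i w => X i w ∨ Y i w) :=
  ES.or HVField.nonempty_carrier hX hY

theorem ESimple.exRV {X : ∀ i : HVField.{v}, W i → LT i.A N → Prop}
    (hX : ESimple (e.ext (.RV N)) (fun i p => X i p.1 p.2)) : ESimple e (fun i w => ∃ ξ, X i w ξ) :=
  ES.ex (s := Srt.RV N) (fun h => nomatch h) hX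

theorem ESimple.exVecRV {κ : Type} [Fintype κ] {X : ∀ i : HVField.{v}, W i → (κ → LT i.A N) → Prop}
    (hX : ESimple (e.vec κ (.RV N)) (fun i p => X i p.1 p.2)) :
    ESimple e (fun i w => ∃ ξ, X i w ξ) :=
  ES.exVec (s := Srt.RV N) (fun h => nomatch h) hX

/-- The sum unfolds into iterated partial additions, at the price of one leading term quantifier for
each partial sum. -/
theorem ESimple.hyperSum {n : ℕ} : ∀ {W : HVField.{v} → Type v} {e : Env HVField.str W}
    {η : ∀ i : HVField.{v}, W i → LT i.A N} {ξ : Fin n → ∀ i : HVField.{v}, W i → LT i.A N},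
    DFRV e N η → (∀ k, DFRV e N (ξ k)) →
    ESimple e (fun i w => η i w ∈ hyperSum i.A (fun k => ξ k i w)) := by
  induction n with
  | zero =>
    intro W e η ξ hη hξ
    exact (ES.eq hη DFRV.zero).congr fun i w => by rw [hyperSum_zero]; rfl
  | succ n ih =>
    intro W e η ξ hη hξ
    have h1 : ESimple (e.ext (.RV N)) (fun i p =>
        (p.2 : LT i.A N) ∈ LeadingTerm.hyperSum i.A (fun k : Fin n => ξ k.succ i p.1) ∧
          Oplus i.A N (ξ 0 i p.1) p.2 (η i p.1)) :=
      (ih (DF.last (Srt.RV N)) (fun k => (hξ k.succ).comp (maps_ext _))).and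
        (ESimple.oplus ((hξ 0).comp (maps_ext _)) (DF.last (Srt.RV N)) (hη.comp (maps_ext _)))
    refine (ESimple.exRV (X := fun i w θ => θ ∈ LeadingTerm.hyperSum i.A (fun k : Fin n =>
      ξ k.succ i w) ∧ Oplus i.A N (ξ 0 i w) θ (η i w)) h1).congr fun i w => ?_
    have : (fun k => ξ k i w) = (Fin.cons (ξ 0 i w) (fun k => ξ k.succ i w) :
        Fin (n + 1) → LT i.A N) := by
      funext k
      refine Fin.cases rfl (fun k => rfl) k
    rw [this, hyperSum_succ]
    rfl

/-- The ring of the functions with values in the valued field that are given by a term. -/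
def ringDF (e : Env HVField.str W) : Subring (∀ i : HVField.{v}, W i → i.K) where
  carrier := {f | DFVF e f}
  zero_mem' := DFVF.zero
  one_mem' := DFVF.one
  add_mem' := DFVF.add
  mul_mem' := DFVF.mul
  neg_mem' := DFVF.neg

/-- Evaluation at a point. -/
def ev (e : Env HVField.str W) (i : HVField.{v}) (w : W i) : ringDF e →+* i.K :=
  ((Pi.evalRingHom _ w).comp (Pi.evalRingHom _ i)).comp (ringDF e).subtype

theorem dfvf_ev (a : ringDF e) : DFVF e (fun i w => ev e i w a) := a.2

end LeadingTerm

/-! ### Passing from a point to its center -/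

namespace LeadingTerm

open ManySorted ManySorted.Env Polynomial

section

variable {K : Type u} [Field K] {A : ValuationSubring K}

theorem hasseDeriv_map {R S : Type*} [Semiring R] [Semiring S] (f : R →+* S) (k : ℕ) (p : R[X]) :
    (hasseDeriv k p).map f = hasseDeriv k (p.map f) := by
  ext n
  simp [hasseDeriv_coeff]

theorem sum_taylor_coeff {f : K[X]} {n : ℕ} (hf : f.natDegree ≤ n) (β z : K) :
    ∑ j : Fin (n + 1), (taylor β f).coeff j * z ^ (j : ℕ) = f.eval (β + z) := by
  rw [add_comm β z, ← taylor_eval, eval_eq_sum_range' (n := n + 1)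
    (by rw [natDegree_taylor]; omega), Fin.sum_univ_eq_sum_range
    (fun j => (taylor β f).coeff j * z ^ j)]

/-- Some `η'` in the sum of the `xⱼ` lies over `η` and is not much smaller than the `xⱼ`. -/
def IsDominantSum (A : ValuationSubring K) {N M : ℕ+} (h : N ∣ M) (N₀ : ℕ+) {n : ℕ}
    (x : Fin n → LT A M) (η : LT A N) : Prop :=
  ∃ η' : LT A M, η' ∈ hyperSum A x ∧
    (∀ j, LTDvd A M η' (x j * rv A M ((N₀ : ℕ) : K))) ∧ proj A h η' = η

theorem isDominantSum_of_le {N M : ℕ+} (h : N ∣ M) (N₀ : ℕ+) {n : ℕ} {y : Fin n → K}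
    (hy : ∀ j, A.valuation (y j) * A.valuation ((N₀ : ℕ) : K) ≤ A.valuation (∑ j, y j)) :
    IsDominantSum A h N₀ (fun j => rv A M (y j)) (rv A N (∑ j, y j)) := by
  refine ⟨rv A M (∑ j, y j), ⟨y, fun _ => rfl, rfl⟩, fun j => ?_, proj_rv _ _ _⟩
  rw [ltDvd_iff, ← rv_mul, val_rv, val_rv, map_mul]
  exact hy j

/-- One choice of representatives whose sum is not too small fixes the leading term of the sum for
every other choice. -/
theorem IsDominantSum.rv_sum_eq [CharZero K] {N M : ℕ+} {h : N ∣ M} {N₀ : ℕ+} (hM : N * N₀ ∣ M)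
    {n : ℕ} {y : Fin n → K} {η : LT A N} (hy : IsDominantSum A h N₀ (fun j => rv A M (y j)) η) :
    rv A N (∑ j, y j) = η := by
  obtain ⟨η', ⟨x, hx, rfl⟩, hdvd, rfl⟩ := hy
  rw [proj_rv, eq_comm]
  refine rv_sum_congr hM hx fun j => ?_
  have := hdvd j
  rwa [ltDvd_iff, ← rv_mul, val_rv, val_rv, map_mul, ← valuation_eq_of_rv_eq (hx j)] at this

theorem natDegree_le_of_coeff_eq_zero {R : Type*} [Semiring R] {p : R[X]} {n : ℕ}
    (hp : p.natDegree ≤ n + 1) (h : p.coeff (n + 1) = 0) : p.natDegree ≤ n := by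
  refine natDegree_le_iff_coeff_eq_zero.2 fun k hk => ?_
  rcases Nat.lt_or_ge (n + 1) k with h' | h'
  · exact coeff_eq_zero_of_natDegree_lt (by omega)
  · rwa [show k = n + 1 by omega]

/-- The coefficients are functions of the parameters, so the leading one can neither be inverted nor
assumed nonzero; it is multiplied in instead. -/
theorem exists_pseudo_division {R : Type*} [CommRing R] (g : R[X]) (d : ℕ)
    (hg : g.natDegree ≤ d + 1) (p : R[X]) :
    ∃ (k : ℕ) (q r : R[X]), r.natDegree ≤ d ∧ C (g.coeff (d + 1)) ^ k * p = q * g + r := by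
  obtain ⟨n, hn⟩ : ∃ n, p.natDegree ≤ n + d := ⟨p.natDegree, by omega⟩
  induction n generalizing p with
  | zero => exact ⟨0, 0, p, by omega, by simp⟩
  | succ n ih =>
    set p' := C (g.coeff (d + 1)) * p - C (p.coeff (n + (d + 1))) * (X ^ n * g) with hp'
    have h1 : p'.natDegree ≤ n + d + 1 := by
      refine (natDegree_sub_le _ _).trans (max_le ?_ ?_)
      · exact (natDegree_C_mul_le _ _).trans (by omega)
      · refine (natDegree_C_mul_le _ _).trans (natDegree_mul_le.trans ?_)
        have := natDegree_X_pow_le (R := R) n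
        omega
    have h2 : p'.coeff (n + d + 1) = 0 := by
      rw [hp', coeff_sub, coeff_C_mul, coeff_C_mul, coeff_X_pow_mul', if_pos (by omega),
        show n + d + 1 - n = d + 1 by omega, show n + d + 1 = n + (d + 1) by omega]
      ring
    obtain ⟨k, q, r, hr, h⟩ := ih p' (natDegree_le_of_coeff_eq_zero h1 h2)
    refine ⟨k + 1, q + C (g.coeff (d + 1)) ^ k * (C (p.coeff (n + (d + 1))) * X ^ n), r, hr, ?_⟩
    rw [hp'] at h
    linear_combination h

end

variable {W : HVField.{v} → Type v} {e : Env HVField.str W}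

/-- The value at `α` of the polynomial with coefficients specialized at `w`. -/
noncomputable def pev (e : Env HVField.str W) (i : HVField.{v}) (w : W i) (p : (ringDF e)[X])
    (α : i.K) : i.K :=
  (p.map (ev e i w)).eval α

theorem ESimple.isDominantSum {N M : ℕ+} (h : N ∣ M) (N₀ : ℕ+) {n : ℕ}
    {x : Fin n → ∀ i : HVField.{v}, W i → LT i.A M} {η : ∀ i : HVField.{v}, W i → LT i.A N}
    (hx : ∀ j, DFRV e M (x j)) (hη : DFRV e N η) :
    ESimple e (fun i w => IsDominantSum i.A h N₀ (fun j => x j i w) (η i w)) := by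
  have hN : DFRV e M (fun i _ => rv i.A M ((N₀ : ℕ) : i.K)) :=
    DFVF.rv M (natCast_mem (ringDF e) (N₀ : ℕ))
  refine ESimple.exRV (X := fun i w η' => η' ∈ LeadingTerm.hyperSum i.A (fun j => x j i w) ∧
    (∀ j, LTDvd i.A M η' (x j i w * rv i.A M ((N₀ : ℕ) : i.K))) ∧ proj i.A h η' = η i w) ?_
  refine (ESimple.hyperSum (DF.last (Srt.RV M)) fun k => (hx k).comp (maps_ext _)).and
    ((ES.all_finite fun j => ?_).and ?_)
  · exact ESimple.ltDvd (DF.last (Srt.RV M)) (DFRV.mul ((hx j).comp (maps_ext _))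
      (hN.comp (maps_ext _)))
  · exact ES.eq (DFRV.proj h (DF.last (Srt.RV M))) (hη.comp (maps_ext _))

/-- Roots of polynomials of degree at most `n` can be eliminated. -/
def RootElim (e : Env HVField.str W) (n : ℕ) : Prop :=
  ∀ g : (ringDF e)[X], g.natDegree ≤ n → ∀ (M : ℕ+) (κ : Type) [Fintype κ]
    (p : κ → (ringDF e)[X]) (θ : ∀ i : HVField.{v}, W i → (κ → LT i.A M) → Prop),
    ESimple (e.vec κ (.RV M)) (fun i q => θ i q.1 q.2) →
    ESimple e (fun i w => ∃ α, g.map (ev e i w) ≠ 0 ∧ pev e i w g α = 0 ∧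
      θ i w (fun k => rv i.A M (pev e i w (p k) α)))

/-- The estimate of `exists_center`. -/
def IsCenter (e : Env HVField.str W) (n : ℕ) {κ : Type} (F : κ → (ringDF e)[X])
    (i : HVField.{v}) (w : W i) (α β : i.K) : Prop :=
  ∀ k j, i.A.valuation ((taylor β ((F k).map (ev e i w))).coeff j) * i.A.valuation (α - β) ^ j *
    i.A.valuation ((centerConst n : ℕ) : i.K) ≤ i.A.valuation (pev e i w (F k) α)

theorem taylor_coeff_pev (i : HVField.{v}) (w : W i) (p : (ringDF e)[X]) (β : i.K) (j : ℕ) :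
    (taylor β (p.map (ev e i w))).coeff j = pev e i w (hasseDeriv j p) β := by
  rw [taylor_coeff, pev, hasseDeriv_map]

theorem natDegree_map_ev_le (i : HVField.{v}) (w : W i) {p : (ringDF e)[X]} {n : ℕ}
    (hp : p.natDegree ≤ n) : (p.map (ev e i w)).natDegree ≤ n :=
  natDegree_map_le.trans hp

/-- The point `α` is replaced by a center `β` and a leading term `ξ` of `α - β`. The side condition
`G` on `α` is traded for its trace `H` on leading terms at `β`: `h₁` is required at centers only,
`h₂` at every `β`. The family `F` may contain polynomials that `θ` does not use but that the center
has to control. As `β` is `0` or a root of a nonzero derivative of some `F k`, of degree at most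
`n`, `hn` eliminates it. -/
theorem esimple_of_center {n : ℕ} (hn : RootElim e n) {κF κ κq : Type} [Fintype κF] [Fintype κ]
    [Fintype κq] (F : κF → (ringDF e)[X]) (hF : ∀ k, (F k).natDegree ≤ n) (c : κ → κF) {M M₁ : ℕ+}
    (hM : M * centerConst n ∣ M₁) (θ : ∀ i : HVField.{v}, W i → (κ → LT i.A M) → Prop)
    (hθ : ESimple (e.vec κ (.RV M)) (fun i q => θ i q.1 q.2)) (q : κq → (ringDF e)[X])
    (H : ∀ i : HVField.{v}, W i → LT i.A M₁ → (κq → LT i.A (M₁ ^ 2)) → Prop)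
    (hH : ESimple ((e.ext (.RV M₁)).vec κq (.RV (M₁ ^ 2))) (fun i q => H i q.1.1 q.1.2 q.2))
    (G : ∀ i : HVField.{v}, W i → i.K → Prop)
    (h₁ : ∀ i w α β, IsCenter e n F i w α β → G i w α →
      H i w (rv i.A M₁ (α - β)) (fun k => rv i.A (M₁ ^ 2) (pev e i w (q k) β)))
    (h₂ : ∀ i w β ξ, H i w ξ (fun k => rv i.A (M₁ ^ 2) (pev e i w (q k) β)) →
      ∃ z, rv i.A M₁ z = ξ ∧ G i w (β + z)) :
    ESimple e (fun i w => ∃ α, G i w α ∧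
      θ i w (fun k => rv i.A M (pev e i w (F (c k)) α))) := by
  have hMM : M ∣ M₁ := (dvd_mul_right _ _).trans hM
  have hsq : M₁ ∣ M₁ ^ 2 := dvd_pow_self M₁ two_ne_zero
  let p' : (κ × Fin (n + 1)) ⊕ κq → (ringDF e)[X] :=
    Sum.elim (fun kj => hasseDeriv kj.2 (F (c kj.1))) q
  -- Here `ω` holds the leading terms at `β` of the Taylor coefficients and of the `q k`; `ξ` stands
  -- for that of `α - β`, and `η k` for that of `F (c k)` at `α`.
  let θ' : ∀ i : HVField.{v}, W i → ((κ × Fin (n + 1)) ⊕ κq → LT i.A (M₁ ^ 2)) → Prop :=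
    fun i w ω => ∃ ξ : LT i.A M₁, ∃ η : κ → LT i.A M,
      (∀ k, IsDominantSum i.A hMM (centerConst n)
        (fun j : Fin (n + 1) => proj i.A hsq (ω (.inl (k, j))) * ξ ^ (j : ℕ)) (η k)) ∧
      θ i w η ∧ H i w ξ (fun k => ω (.inr k))
  have hθ' : ESimple (e.vec ((κ × Fin (n + 1)) ⊕ κq) (.RV (M₁ ^ 2)))
      (fun i q => θ' i q.1 q.2) := by
    refine ESimple.exRV (ESimple.exVecRV ((ES.all_finite fun k => ?_).and (ES.and ?_ ?_)))
    · refine ESimple.isDominantSum hMM (centerConst n) (fun j => DFRV.mul (DFRV.proj hsq ?_)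
        (DFRV.pow ?_ _)) (DF.coord (Srt.RV M) k)
      · exact (DF.coord (Srt.RV (M₁ ^ 2)) _).comp ((maps_ext _).comp (maps_vec _ _))
      · exact (DF.last (Srt.RV M₁)).comp (maps_vec _ _)
    · have h3 : (((e.vec ((κ × Fin (n + 1)) ⊕ κq) (.RV (M₁ ^ 2))).ext (.RV M₁)).vec κ (.RV M)).Maps
          (e.vec κ (.RV M)) (fun i p => (p.1.1.1, fun k => p.2 k)) :=
        Maps.vec (fun k => DF.coord (Srt.RV M) k)
          ((maps_vec _ _).comp ((maps_ext _).comp (maps_vec _ _)))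
      exact hθ.comp h3
    · have h3 : ((e.vec ((κ × Fin (n + 1)) ⊕ κq) (.RV (M₁ ^ 2))).ext (.RV M₁)).Maps
          (e.ext (.RV M₁)) (fun i p => (p.1.1, p.2)) := by
        intro s x
        cases x with
        | zero => exact DF.last (Srt.RV M₁)
        | succ x => exact ((maps_vec _ _).comp (maps_ext _)) _ x
      have h4 : (((e.vec ((κ × Fin (n + 1)) ⊕ κq) (.RV (M₁ ^ 2))).ext (.RV M₁)).vec κ (.RV M)).Maps
          ((e.ext (.RV M₁)).vec κq (.RV (M₁ ^ 2)))
          (fun i p => ((p.1.1.1, p.1.2), fun k => p.1.1.2 (Sum.inr k))) :=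
        Maps.vec (fun k => (DF.coord (Srt.RV (M₁ ^ 2)) (Sum.inr k)).comp
          ((maps_ext _).comp (maps_vec _ _))) (h3.comp (maps_vec _ _))
      exact hH.comp h4
  have key : ∀ i w, (∃ α, G i w α ∧ θ i w (fun k => rv i.A M (pev e i w (F (c k)) α))) ↔
      (θ' i w (fun k => rv i.A (M₁ ^ 2) (pev e i w (p' k) 0)) ∨
        ∃ (kj : κF × Fin (n + 1)), ∃ β, (derivative^[kj.2] (F kj.1)).map (ev e i w) ≠ 0 ∧
          pev e i w (derivative^[kj.2] (F kj.1)) β = 0 ∧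
          θ' i w (fun k => rv i.A (M₁ ^ 2) (pev e i w (p' k) β))) := by
    intro i w
    have hsum : ∀ k β z, ∑ j : Fin (n + 1), pev e i w (hasseDeriv j (F k)) β * z ^ (j : ℕ) =
        pev e i w (F k) (β + z) := by
      intro k β z
      rw [pev, ← sum_taylor_coeff (natDegree_map_ev_le i w (hF k))]
      simp only [taylor_coeff_pev]
    constructor
    · rintro ⟨α, hG, hθα⟩
      obtain ⟨β, hβ, hcen⟩ := exists_center i.henselian (fun k => (F k).map (ev e i w)) n
        (fun k => natDegree_map_ev_le i w (hF k)) α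
      have hθβ : θ' i w (fun k => rv i.A (M₁ ^ 2) (pev e i w (p' k) β)) := by
        refine ⟨rv i.A M₁ (α - β), fun k => rv i.A M (pev e i w (F (c k)) α), fun k => ?_, hθα,
          h₁ i w α β hcen hG⟩
        have h := isDominantSum_of_le (A := i.A) hMM (centerConst n)
          (y := fun j : Fin (n + 1) => pev e i w (hasseDeriv j (F (c k))) β * (α - β) ^ (j : ℕ))
          (fun j => by
            rw [hsum, add_sub_cancel, map_mul, map_pow, ← taylor_coeff_pev]
            exact hcen (c k) j)
        rw [hsum, add_sub_cancel] at h
        simp only [rv_mul, rv_pow] at h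
        simp only [proj_rv]
        exact h
      rcases hβ with rfl | ⟨k, j, h0, hr⟩
      · exact Or.inl hθβ
      · rw [iterate_derivative_map] at h0 hr
        exact Or.inr ⟨(k, j), β, h0, hr, hθβ⟩
    -- In this direction `β` need not be known to be a center: the dominance recorded in `θ'`
    -- already fixes the leading terms at `β + z`.
    · intro h
      obtain ⟨β, ξ, η, hη, hθη, hHβ⟩ :
          ∃ β, θ' i w (fun k => rv i.A (M₁ ^ 2) (pev e i w (p' k) β)) := by
        rcases h with h | ⟨_, β, _, _, h⟩
        exacts [⟨0, h⟩, ⟨β, h⟩]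
      obtain ⟨z, rfl, hG⟩ := h₂ i w β ξ hHβ
      refine ⟨β + z, hG, ?_⟩
      have : η = fun k => rv i.A M (pev e i w (F (c k)) (β + z)) := by
        funext k
        have h := hη k
        simp only [proj_rv, ← rv_pow] at h
        have h' := IsDominantSum.rv_sum_eq hM (y := fun j : Fin (n + 1) =>
          pev e i w (hasseDeriv j (F (c k))) β * z ^ (j : ℕ)) (by simp only [rv_mul]; exact h)
        rw [← h', hsum]
      rwa [this] at hθη
  refine ES.congr (ESimple.or ?_ (ES.ex_finite HVField.nonempty_carrier fun kj => ?_)) key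
  · refine hθ'.comp (Maps.vec (f := fun k i w => rv i.A (M₁ ^ 2) (pev e i w (p' k) 0))
      (fun k => DFVF.rv _ ?_) maps_id)
    have : ∀ i w, pev e i w (p' k) 0 = ev e i w ((p' k).coeff 0) := by
      intro i w
      rw [pev, ← coeff_zero_eq_eval_zero, coeff_map]
    simp only [this]
    exact dfvf_ev _
  · refine hn _ ?_ _ _ p' θ' hθ'
    exact (natDegree_iterate_derivative _ _).trans ((Nat.sub_le _ _).trans (hF _))

end LeadingTerm

/-! ### Induction on the degree -/

namespace LeadingTerm

open ManySorted ManySorted.Env Polynomial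

variable {W : HVField.{v} → Type v} {e : Env HVField.str W}

/-- The clause that the specialized `g` is nonzero makes this case empty. -/
theorem rootElim_zero : RootElim e 0 := by
  intro g hg M κ _ p θ hθ
  refine ES.false.congr fun i w => ?_
  simp only [iff_false, not_exists, not_and]
  intro α h0 hα
  obtain ⟨c, rfl⟩ := natDegree_eq_zero.1 (Nat.le_zero.1 hg)
  rw [map_C, ne_eq, C_eq_zero] at h0
  rw [pev, map_C, eval_C] at hα
  exact absurd hα h0

/-- The induction step, when the leading coefficient does not vanish and the polynomials `r` have
smaller degree. -/
theorem esimple_root_of_leadingCoeff_ne_zero {d : ℕ} (hd : RootElim e d) (g : (ringDF e)[X])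
    (hg : g.natDegree ≤ d + 1) (M : ℕ+) (κ : Type) [Fintype κ] (r : κ → (ringDF e)[X])
    (hr : ∀ k, (r k).natDegree ≤ d) (θ : ∀ i : HVField.{v}, W i → (κ → LT i.A M) → Prop)
    (hθ : ESimple (e.vec κ (.RV M)) (fun i q => θ i q.1 q.2)) :
    ESimple e (fun i w => ∃ α, (ev e i w (g.coeff (d + 1)) ≠ 0 ∧ pev e i w g α = 0) ∧
      θ i w (fun k => rv i.A M (pev e i w (r k) α))) := by
  let f : ℕ+ := ⟨(d + 1).factorial, Nat.factorial_pos _⟩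
  -- The factor `M * centerConst d` fixes leading terms at level `M`, and `centerConst d * f` is the
  -- divisor required by `henselLift_of_root`.
  let M₁ : ℕ+ := M * centerConst d * f
  -- The predicate excludes `ξ = 0`, so the case where `β` is itself the root is listed separately.
  let H : ∀ i : HVField.{v}, W i → LT i.A M₁ → (Fin (d + 2) → LT i.A (M₁ ^ 2)) → Prop :=
    fun i w ξ ω => ev e i w (g.coeff (d + 1)) ≠ 0 ∧
      ((ξ = 0 ∧ ω 0 = 0) ∨ HenselLift i.A M₁ (d + 1) ξ ω)
  have hne : ∀ i w, ev e i w (g.coeff (d + 1)) ≠ 0 → g.map (ev e i w) ≠ 0 := by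
    intro i w h h'
    rw [← coeff_map, h', coeff_zero] at h
    exact h rfl
  -- The extra index `none` carries the derivative of `g`, so that the center also bounds it from
  -- below at `α`, as `henselLift_of_root` demands. Since `g` itself is not in the family, all
  -- degrees are at most `d`.
  refine esimple_of_center hd (κF := Option κ) (M₁ := M₁)
    (fun k => k.elim (derivative g) r) ?_ some (dvd_mul_right _ f) θ hθ
    (fun j : Fin (d + 2) => hasseDeriv j g) H ?_
    (fun i w α => ev e i w (g.coeff (d + 1)) ≠ 0 ∧ pev e i w g α = 0) ?_ ?_
  · rintro (_ | k)
    · exact (natDegree_derivative_le g).trans (by omega)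
    · exact hr k
  · refine ES.and ?_ (ESimple.or (ES.and ?_ ?_) ?_)
    · exact ((ES.ne (s := Srt.VF) (dfvf_ev (g.coeff (d + 1))) DFVF.zero).comp
        ((maps_ext (.RV M₁)).comp (maps_vec (Fin (d + 2)) (.RV (M₁ ^ 2)))) :)
    · exact ES.eq ((DF.last (Srt.RV M₁)).comp (maps_vec _ _)) DFRV.zero
    · exact ES.eq (DF.coord (Srt.RV (M₁ ^ 2)) 0) DFRV.zero
    · exact ESimple.henselLift ((DF.last (Srt.RV M₁)).comp (maps_vec _ _))
        (fun k => DF.coord (Srt.RV (M₁ ^ 2)) k)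
  · rintro i w α β hcen ⟨hc, hα⟩
    refine ⟨hc, ?_⟩
    by_cases hz : α - β = 0
    · left
      refine ⟨by rw [hz, rv_zero], ?_⟩
      rw [rv_eq_zero, Fin.val_zero, hasseDeriv_zero', ← sub_eq_zero.1 hz, hα]
    · right
      simp only [← taylor_coeff_pev]
      refine henselLift_of_root (N₀ := centerConst d) (taylor β (g.map (ev e i w)))
        (by rw [natDegree_taylor]; exact natDegree_map_ev_le i w hg)
        (by rw [ne_eq, taylor_eq_zero]; exact hne i w hc) hz ?_ ?_ ?_
      · rw [taylor_eval, sub_add_cancel]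
        exact hα
      · exact ⟨M, by simp only [M₁, f]; ac_rfl⟩
      · intro j
        have := hcen none j
        rw [derivative_taylor_comm, derivative_map, taylor_eval, sub_add_cancel]
        exact this
  · rintro i w β ξ ⟨hc, h | h⟩
    · obtain ⟨rfl, h⟩ := h
      refine ⟨0, rv_zero _ _, hc, ?_⟩
      rw [rv_eq_zero, Fin.val_zero, hasseDeriv_zero'] at h
      rw [add_zero, h]
    · simp only [← taylor_coeff_pev] at h
      obtain ⟨z, hz, hroot⟩ := exists_root_of_henselLift i.henselian
        (taylor β (g.map (ev e i w)))
        (by rw [natDegree_taylor]; exact natDegree_map_ev_le i w hg) h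
      refine ⟨z, hz, hc, ?_⟩
      rwa [taylor_eval, add_comm] at hroot

theorem rootElim (n : ℕ) : RootElim e n := by
  induction n with
  | zero => exact rootElim_zero
  | succ d ih =>
    intro g hg M κ _ p θ hθ
    choose m q r hr hqr using fun k => exists_pseudo_division g d hg (p k)
    -- At a root of `g` the remainder `r k` is a power of the leading coefficient times `p k`. The
    -- condition `θ'` divides by this power at the level of leading terms, through the quantifier
    -- over `ζ`.
    let θ' : ∀ i : HVField.{v}, W i → (κ → LT i.A M) → Prop := fun i w ζ' =>
      ∃ ζ : κ → LT i.A M, θ i w ζ ∧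
        ∀ k, rv i.A M (ev e i w (g.coeff (d + 1))) ^ m k * ζ k = ζ' k
    have hθ' : ESimple (e.vec κ (.RV M)) (fun i q => θ' i q.1 q.2) := by
      have h3 : ((e.vec κ (.RV M)).vec κ (.RV M)).Maps
          (e.vec κ (.RV M)) (fun i p => (p.1.1, fun k => p.2 k)) :=
        Maps.vec (fun k => DF.coord (Srt.RV M) k) ((maps_vec _ _).comp (maps_vec _ _))
      refine ESimple.exVecRV (ES.and (hθ.comp h3) (ES.all_finite fun k => ES.eq
        (DFRV.mul (DFRV.pow ?_ _) (DF.coord (Srt.RV M) k))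
        ((DF.coord (Srt.RV M) k).comp (maps_vec _ _))))
      exact ((DFVF.rv M (dfvf_ev (g.coeff (d + 1)))).comp 
        ((maps_vec κ (.RV M)).comp (maps_vec κ (.RV M))) :)
    -- Where the leading coefficient vanishes, `g` specializes to the same polynomial as `g.erase (d
    -- + 1)`, of smaller degree.
    have h1 := ih (g.erase (d + 1)) (natDegree_le_of_coeff_eq_zero
      ((natDegree_le_iff_coeff_eq_zero.2 fun k hk => by
        rw [coeff_erase]
        split
        · rfl
        · exact coeff_eq_zero_of_natDegree_lt (by omega))) (by rw [coeff_erase, if_pos rfl]))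
      M κ p θ hθ
    have h2 := esimple_root_of_leadingCoeff_ne_zero ih g hg M κ r hr θ' hθ'
    have h0 : ESimple e (fun i w => ev e i w (g.coeff (d + 1)) = 0) :=
      ES.eq (s := Srt.VF) (dfvf_ev _) DFVF.zero
    refine (ESimple.or (h0.and h1) h2).congr fun i w => ?_
    by_cases hc : ev e i w (g.coeff (d + 1)) = 0
    · have hg' : (g.erase (d + 1)).map (ev e i w) = g.map (ev e i w) := by
        conv_rhs => rw [← monomial_add_erase g (d + 1)]
        rw [Polynomial.map_add, map_monomial, hc, monomial_zero_right, zero_add]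
      simp only [pev, hg', hc, ne_eq, not_true_eq_false, false_and, exists_false, or_false,
        true_and]
    · have hne : g.map (ev e i w) ≠ 0 := by
        intro h'
        rw [← coeff_map, h', coeff_zero] at hc
        exact hc rfl
      simp only [hc, hne, ne_eq, not_false_eq_true, true_and, false_and, false_or]
      refine exists_congr fun α => and_congr_right fun hα => ?_
      have hrv : ∀ k, rv i.A M (pev e i w (r k) α) =
          rv i.A M (ev e i w (g.coeff (d + 1))) ^ m k * rv i.A M (pev e i w (p k) α) := by
        intro k
        rw [← rv_pow, ← rv_mul]
        congr 1
        have := congrArg (fun P => pev e i w P α) (hqr k)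
        simp only [pev, Polynomial.map_add, Polynomial.map_mul, Polynomial.map_pow, map_C, eval_add,
          eval_mul, eval_pow, eval_C] at this hα ⊢
        rw [this, hα]
        ring
      simp only [hrv]
      have hc' : rv i.A M (ev e i w (g.coeff (d + 1))) ≠ 0 := by rwa [ne_eq, rv_eq_zero]
      constructor
      · intro h
        exact ⟨_, h, fun k => rfl⟩
      · rintro ⟨ζ, hζ, h⟩
        have : ζ = fun k => rv i.A M (pev e i w (p k) α) := by
          funext k
          exact mul_left_cancel₀ (pow_ne_zero _ hc') (h k)
        rwa [this] at hζ

/-- Elimination of one quantifier over the valued field. -/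
theorem esimple_exists (M : ℕ+) (κ : Type) [Fintype κ] (p : κ → (ringDF e)[X])
    (θ : ∀ i : HVField.{v}, W i → (κ → LT i.A M) → Prop)
    (hθ : ESimple (e.vec κ (.RV M)) (fun i q => θ i q.1 q.2)) :
    ESimple e (fun i w => ∃ α, θ i w (fun k => rv i.A M (pev e i w (p k) α))) := by
  obtain ⟨n, hn⟩ : ∃ n, ∀ k, (p k).natDegree ≤ n :=
    ⟨Finset.univ.sup fun k => (p k).natDegree, fun k =>
      Finset.le_sup (f := fun k => (p k).natDegree) (Finset.mem_univ k)⟩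
  -- There is no side condition on `α`, and every leading term lifts to some `z`.
  refine (esimple_of_center (rootElim n) p hn id (dvd_refl (M * centerConst n)) θ hθ
    (fun k : Empty => k.elim) (fun _ _ _ _ => True) ES.true (fun _ _ _ => True)
    (fun _ _ _ _ _ _ => trivial) (fun i w β ξ _ => ?_)).congr fun i w => by
      simp only [true_and, id]
  obtain ⟨z, hz⟩ := rv_surjective _ ξ
  exact ⟨z, hz, trivial⟩

end LeadingTerm

/-! ### Transfer from fields to all models -/

namespace ManySorted.Env

variable {S : Type} {L : Signature.{u} S} {ι : Type*}

/-- The environment of all tuples with given sorts. -/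
def tuples (𝔐 : ι → Struct.{u, w} L) (Γ : List S) : Env 𝔐 (fun i => Tuple (𝔐 i).carrier Γ) where
  ctx := Γ
  val _ v := v

end ManySorted.Env

namespace LeadingTerm

open ManySorted ManySorted.Env Polynomial

/-- The universal closure of the equivalence is true in all the fields, hence belongs to the theory.
Arbitrary models thus need no algebra of their own. -/
theorem holds_iff_of_natural {Γ : List Srt} {φ ψ : Formula LRV Γ}
    (h : ∀ (i : HVField.{v}) x, φ.Holds i.str x ↔ ψ.Holds i.str x) {M : Struct.{0, w} LRV}
    (hM : M.IsModel THen0.{v}) (x : Tuple M.carrier Γ) : φ.Holds M x ↔ ψ.Holds M x := by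
  have h1 : (φ.iff ψ).closure ∈ THen0.{v} := fun K _ _ A h1 h2 =>
    (Formula.holds_closure _ _).2 fun v => (Formula.holds_iff _ _ _ _).2 (h ⟨K, A, h1, h2⟩ v)
  exact (Formula.holds_iff _ _ _ _).1 ((Formula.holds_closure _ _).1 (hM _ h1) x)

/-- A term defines a polynomial function of its first variable. -/
def IsPolynomial {W : HVField.{v} → Type v} (e : Env HVField.str W) :
    (s : Srt) → (∀ i : HVField.{v}, W i → i.K → i.str.carrier s) → Prop
  | .VF, f => ∃ p : (ringDF e)[X], ∀ i w α, pev e i w p α = f i w α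
  | .RV _, _ => True

/-- Symbols with values in the field take only field arguments. The empty claim for the leading term
sorts lets the induction run over all terms. -/
theorem isPolynomial_term {W : HVField.{v} → Type v} {e : Env HVField.str W} {Γ : List Srt}
    {τ : ∀ i : HVField.{v}, W i → Tuple i.str.carrier Γ} (hτ : e.Maps (tuples HVField.str Γ) τ)
    {s : Srt} (t : Term LRV (.VF :: Γ) s) :
    IsPolynomial e s
      (fun i w α => t.eval i.str (Tuple.cons (s := Srt.VF) (X := i.str.carrier) α (τ i w))) := by
  induction t with
  | @var s x =>
    cases x with
    | zero => exact ⟨X, fun i w α => by simp [pev]; rfl⟩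
    | succ y =>
      cases s with
      | VF => exact ⟨C ⟨_, hτ Srt.VF y⟩, fun i w α => by simp [pev]; rfl⟩
      | RV N => trivial
  | app f ts ih =>
    cases f with
    | zero => exact ⟨0, fun i w α => by simp [pev]; rfl⟩
    | one => exact ⟨1, fun i w α => by simp [pev]; rfl⟩
    | add =>
      obtain ⟨p, hp⟩ := ih (0 : Fin 2)
      obtain ⟨q, hq⟩ := ih (1 : Fin 2)
      refine ⟨p + q, fun i w α => ?_⟩
      rw [pev, Polynomial.map_add, eval_add, ← pev, ← pev, hp, hq]
      rfl
    | neg =>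
      obtain ⟨p, hp⟩ := ih (0 : Fin 1)
      refine ⟨-p, fun i w α => ?_⟩
      rw [pev, Polynomial.map_neg, eval_neg, ← pev, hp]
      rfl
    | mul =>
      obtain ⟨p, hp⟩ := ih (0 : Fin 2)
      obtain ⟨q, hq⟩ := ih (1 : Fin 2)
      refine ⟨p * q, fun i w α => ?_⟩
      rw [pev, Polynomial.map_mul, eval_mul, ← pev, ← pev, hp, hq]
      rfl
    | zeroRV N => trivial
    | oneRV N => trivial
    | mulRV N => trivial
    | rv N => trivial
    | proj N M h => trivial

/-- The variable `x` of `VF :: Γ`, with a block of variables inserted after the first one. -/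
def insertBlock {Γ : List Srt} (m : ℕ) (s : Srt) :
    ∀ t, Var (.VF :: Γ) t → Term LRV (.VF :: (List.replicate m s ++ Γ)) t
  | _, .zero => .var .zero
  | _, .succ y => .var (.succ (Var.rest y))

/-- The formula `∃ α, ⋀ₖ rv_M (tₖ(α, u)) = ζₖ` in the variables `ζ, u`. -/
noncomputable def leadingTermsFormula (M : ℕ+) {κ : Type} [Fintype κ] {Γ : List Srt}
    (t : κ → Term LRV (.VF :: Γ) .VF) :
    Formula LRV (List.replicate (Fintype.card κ) (.RV M) ++ Γ) :=
  .ex .VF (.conj fun k => .eq (s := .RV M)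
    (Term.app (L := LRV) (LRVFunc.rv M)
      (fun _ => (t ((Fintype.equivFin κ).symm k)).subst (insertBlock _ _)))
    (.var (.succ (Var.block k))))

theorem holds_leadingTermsFormula (N : Struct.{0, w} LRV) (M : ℕ+) {κ : Type} [Fintype κ]
    {Γ : List Srt} (t : κ → Term LRV (.VF :: Γ) .VF) (ζ : κ → N.carrier (.RV M))
    (u : Tuple N.carrier Γ) :
    (leadingTermsFormula M t).Holds N
        (Tuple.vcons (fun k => ζ ((Fintype.equivFin κ).symm k)) u) ↔
      ∃ a : N.carrier .VF, ∀ k,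
        N.func (LRVFunc.rv M) (fun _ => (t k).eval N (Tuple.cons a u)) = ζ k := by
  refine exists_congr fun a => (Formula.holds_conj _ _ _).trans ?_
  rw [← (Fintype.equivFin κ).symm.forall_congr_right]
  refine forall_congr' fun k => ?_
  have h1 : (fun s x => (insertBlock (Γ := Γ) (Fintype.card κ) (.RV M) s x).eval N
      (Tuple.cons a (Tuple.vcons (fun k => ζ ((Fintype.equivFin κ).symm k)) u))) =
      Tuple.cons a u := by
    funext s x
    cases x with
    | zero => rfl
    | succ y => exact Tuple.vcons_rest _ _ _
  exact Eq.congr (congrArg (N.func (LRVFunc.rv M)) (funext fun _ =>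
    (Term.eval_subst _ _ _ _).trans (by rw [h1]; rfl))) (Tuple.vcons_block _ _ _)

/-- Every field quantifier in an expansion will be reduced to this formula. The `ζ` are parameters,
and `esimple_exists` is applied to the condition that the leading terms equal them. -/
theorem exists_simple_leadingTermsFormula (M : ℕ+) {κ : Type} [Fintype κ] {Γ : List Srt}
    (t : κ → Term LRV (.VF :: Γ) .VF) :
    ∃ χ : Formula LRV (List.replicate (Fintype.card κ) (.RV M) ++ Γ), IsExistsSimple χ ∧
      ∀ N : Struct.{0, w} LRV, N.IsModel THen0.{v} → ∀ z,
        χ.Holds N z ↔ (leadingTermsFormula M t).Holds N z := by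
  choose p hp using fun k => isPolynomial_term (e := (tuples HVField.str.{v} Γ).vec κ (.RV M))
    (τ := fun i p => p.1) (maps_vec κ (Srt.RV M)) (t k)
  obtain ⟨χ, hχ, h⟩ := esimple_exists M κ p (fun i w ζ' => ∀ k, ζ' k = w.2 k)
    (ES.all_finite fun k => ES.eq (DF.coord (Srt.RV M) k)
      ((DF.coord (Srt.RV M) k).comp (maps_vec κ (Srt.RV M))))
  refine ⟨χ, hχ, fun N hN z => holds_iff_of_natural (fun i z => ?_) hN z⟩
  obtain ⟨ζ, u, rfl⟩ := Tuple.exists_eq_vcons z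
  have h2 : ζ = fun k => (fun k => ζ (Fintype.equivFin κ k)) ((Fintype.equivFin κ).symm k) := by
    funext k
    simp
  rw [h2]
  refine (h i (u, fun k => ζ (Fintype.equivFin κ k))).trans
    (Iff.trans ?_ (holds_leadingTermsFormula i.str M t
      (fun k => ζ (Fintype.equivFin κ k)) u).symm)
  exact exists_congr fun α => forall_congr' fun k =>
    Eq.congr (congrArg (rv i.A M) (hp k i (u, _) α)) rfl

end LeadingTerm

namespace ManySorted.Env

variable {S : Type} {L : Signature.{u} S} {ι : Type*} {𝔐 : ι → Struct.{u, w} L} {W W' : ι → Type*}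
  {e : Env 𝔐 W} {e' : Env 𝔐 W'}

theorem DF.congr {s : S} {f g : ∀ i, W i → (𝔐 i).carrier s} (hf : e.DF f)
    (h : ∀ i w, g i w = f i w) : e.DF g := by
  obtain ⟨t, ht⟩ := hf
  exact ⟨t, fun i w => (ht i w).trans (h i w).symm⟩

theorem Maps.ext {τ : ∀ i, W' i → W i} (hτ : e'.Maps e τ) (s : S) :
    (e'.ext s).Maps (e.ext s) (fun i p => (τ i p.1, p.2)) := by
  intro t x
  cases x with
  | zero => exact DF.last s
  | succ x => exact (hτ t x).comp (maps_ext s)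

end ManySorted.Env

namespace LeadingTerm

open ManySorted ManySorted.Env

variable {E : RVExpansion.{u}}

/-! ### Formulas of the language of leading terms as formulas of an expansion -/

/-- A term of the language of leading terms as a term of an expansion. -/
def liftTerm {Γ : List Srt} : {s : Srt} → Term LRV Γ s → Term E.lang Γ s
  | _, .var x => .var x
  | _, .app f ts => .app (L := E.lang) (Sum.inl f) (fun i => liftTerm (ts i))

/-- A formula of the language of leading terms as a formula of an expansion. -/
def liftFormula : {Γ : List Srt} → Formula LRV Γ → Formula E.lang Γ
  | _, .falsum => .falsum
  | _, .eq t₁ t₂ => .eq (liftTerm t₁) (liftTerm t₂)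
  | _, .rel r ts => .rel (L := E.lang) (Sum.inl r) (fun i => liftTerm (ts i))
  | _, .not φ => .not (liftFormula φ)
  | _, .and φ ψ => .and (liftFormula φ) (liftFormula ψ)
  | _, .or φ ψ => .or (liftFormula φ) (liftFormula ψ)
  | _, .all s φ => .all s (liftFormula φ)
  | _, .ex s φ => .ex s (liftFormula φ)

theorem eval_liftTerm (M : Struct.{u, w} E.lang) {Γ : List Srt} (v : Tuple M.carrier Γ) {s : Srt}
    (t : Term LRV Γ s) : (liftTerm t).eval M v = t.eval (reduct M) v := by
  induction t with
  | var x => rfl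
  | app f ts ih => exact congrArg (M.func (Sum.inl f)) (funext ih)

theorem holds_liftFormula (M : Struct.{u, w} E.lang) {Γ : List Srt} (φ : Formula LRV Γ) :
    ∀ v : Tuple M.carrier Γ, (liftFormula φ).Holds M v ↔ φ.Holds (reduct M) v := by
  induction φ with
  | falsum => exact fun v => Iff.rfl
  | eq t₁ t₂ => exact fun v => Eq.congr (eval_liftTerm M v t₁) (eval_liftTerm M v t₂)
  | rel r ts =>
    exact fun v => iff_of_eq (congrArg (M.rel (Sum.inl r)) (funext fun i => eval_liftTerm M v (ts i)))
  | not φ ih => exact fun v => not_congr (ih v)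
  | and φ ψ ih₁ ih₂ => exact fun v => and_congr (ih₁ v) (ih₂ v)
  | or φ ψ ih₁ ih₂ => exact fun v => or_congr (ih₁ v) (ih₂ v)
  | all s φ ih => exact fun v => forall_congr' fun a => ih (Tuple.cons a v)
  | ex s φ ih => exact fun v => exists_congr fun a => ih (Tuple.cons a v)

theorem isQF_liftFormula {Γ : List Srt} {φ : Formula LRV Γ} (h : φ.IsQF) :
    (liftFormula φ : Formula E.lang Γ).IsQF := by
  induction φ with
  | falsum => trivial
  | eq t₁ t₂ => trivial
  | rel r ts => trivial
  | not φ ih => exact ih h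
  | and φ ψ ih₁ ih₂ => exact ⟨ih₁ h.1, ih₂ h.2⟩
  | or φ ψ ih₁ ih₂ => exact ⟨ih₁ h.1, ih₂ h.2⟩
  | all s φ => exact h.elim
  | ex s φ => exact h.elim

theorem isExistentialOver_liftFormula {Q : Srt → Prop} {Γ : List Srt} {φ : Formula LRV Γ}
    (h : φ.IsExistentialOver Q) : (liftFormula φ : Formula E.lang Γ).IsExistentialOver Q := by
  induction h with
  | qf h => exact .qf (isQF_liftFormula h)
  | ex hs _ ih => exact .ex hs ih

/-! ### Two facts that hold in all models -/

/-- This turns equations between field terms into equations between leading terms, so that field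
terms occur only below `rv`. -/
theorem eq_iff_rv_sub_eq_zero {M : Struct.{0, w} LRV} (hM : M.IsModel THen0.{v})
    (a b : M.carrier .VF) :
    a = b ↔ M.func (LRVFunc.rv 1) (fun _ => M.func LRVFunc.add
      (fun j : Fin 2 => (Fin.cases a (fun _ => M.func LRVFunc.neg (fun _ => b)) j : M.carrier .VF)))
      = M.func (LRVFunc.zeroRV 1) (fun j => j.elim0) := by
  let x : Term LRV [.VF, .VF] .VF := .var .zero
  let y : Term LRV [.VF, .VF] .VF := .var (.succ .zero)
  let t : Term LRV [.VF, .VF] .VF := .app (L := LRV) LRVFunc.add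
    (fun j : Fin 2 => (Fin.cases x (fun _ => .app (L := LRV) LRVFunc.neg (fun _ => y)) j :
      Term LRV [.VF, .VF] .VF))
  have h := holds_iff_of_natural.{v, w} (φ := .eq x y) (ψ := .eq (s := .RV 1)
    (.app (L := LRV) (LRVFunc.rv 1) (fun _ => t))
    (.app (L := LRV) (LRVFunc.zeroRV 1) (fun j => j.elim0))) (fun i z => ?_) hM
    (Tuple.cons a (Tuple.cons b Tuple.nil))
  · refine h.trans (Eq.congr (congrArg (M.func (LRVFunc.rv 1)) (funext fun _ =>
      congrArg (M.func LRVFunc.add) (funext fun j => ?_)))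
      (congrArg (M.func (LRVFunc.zeroRV 1)) (funext fun j => j.elim0)))
    exact Fin.cases (motive := fun j : Fin 2 => Term.eval M _ (Fin.cases x (fun _ =>
      .app (L := LRV) LRVFunc.neg (fun _ => y)) j : Term LRV [.VF, .VF] .VF) =
      (Fin.cases a (fun _ => M.func LRVFunc.neg (fun _ => b)) j : M.carrier .VF)) rfl
      (fun _ => rfl) j
  · have h0 : ∀ x y : i.K, x = y ↔ rv i.A 1 (x + -y) = 0 := fun x y => by
      rw [rv_eq_zero, ← sub_eq_add_neg, sub_eq_zero]
    exact h0 _ _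

theorem proj_rv_of_isModel {M : Struct.{0, w} LRV} (hM : M.IsModel THen0.{v}) {N N' : ℕ+}
    (h : N ∣ N') (a : M.carrier .VF) :
    M.func (LRVFunc.proj N N' h) (fun _ => M.func (LRVFunc.rv N') (fun _ => a)) =
      M.func (LRVFunc.rv N) (fun _ => a) := by
  let x : Term LRV [.VF] .VF := .var .zero
  have h := holds_iff_of_natural.{v, w} (φ := .eq (s := .RV N)
    (.app (L := LRV) (LRVFunc.proj N N' h) (fun _ => .app (L := LRV) (LRVFunc.rv N') (fun _ => x)))
    (.app (L := LRV) (LRVFunc.rv N) (fun _ => x))) (ψ := .not .falsum) (fun i z => ?_) hM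
    (Tuple.cons a Tuple.nil)
  · exact h.2 not_false
  · exact iff_of_true (proj_rv i.A _ _) not_false

/-! ### Unnesting -/

/-- Finitely many leading terms, of the same order, of valued field terms. -/
structure RVData (E : RVExpansion.{u}) (Δ : List Srt) where
  /-- the order -/
  level : ℕ+
  /-- the index set -/
  idx : Type
  [fintype : Fintype idx]
  /-- the terms -/
  term : idx → Term E.lang Δ .VF

attribute [instance] RVData.fintype

variable {ι : Type*} {Γ Δ : List Srt} {𝔐 : ι → Struct.{u, w} E.lang}

/-- The leading terms of the terms in `D`. -/
def RVData.val (D : RVData E Δ) (M : Struct.{u, w} E.lang) (z : Tuple M.carrier Δ) (k : D.idx) :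
    M.carrier (.RV D.level) :=
  M.func (Sum.inl (LRVFunc.rv D.level)) (fun _ => (D.term k).eval M z)

/-- The environment that consists of the variables in the image of `ρ` and the leading terms of the
terms in `D`. -/
noncomputable def RVData.env (𝔐 : ι → Struct.{u, w} E.lang) (ρ : ∀ s, Var Γ s → Var Δ s)
    (D : RVData E Δ) : Env 𝔐 (fun i => Tuple (𝔐 i).carrier Δ) :=
  ((tuples 𝔐 Γ).vec D.idx (.RV D.level)).pull
    (fun i z => (fun s x => z s (ρ s x), fun k => D.val (𝔐 i) z k))

variable {ρ : ∀ s, Var Γ s → Var Δ s}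

theorem RVData.maps_base (D : RVData E Δ) :
    (D.env 𝔐 ρ).Maps (tuples 𝔐 Γ) (fun _ z => (fun s x => z s (ρ s x))) :=
  ((maps_vec (e := tuples 𝔐 Γ) D.idx (Srt.RV D.level)).comp (maps_pull _ _) :)

theorem RVData.df_val (D : RVData E Δ) (k : D.idx) :
    (D.env 𝔐 ρ).DF (s := .RV D.level) (fun i z => D.val (𝔐 i) z k) :=
  (DF.coord (Srt.RV D.level) k).comp (maps_pull _ _)

/-- The common level is the product of the levels; the projections recover the original leading
terms. -/
theorem RVData.exists_upper (h𝔐 : ∀ i, (reduct (𝔐 i)).IsModel THen0.{v}) {J : Type} [Fintype J]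
    (D : J → RVData E Δ) :
    ∃ D' : RVData E Δ, ∀ j, (D'.env 𝔐 ρ).Maps ((D j).env 𝔐 ρ) (fun _ z => z) := by
  refine ⟨⟨∏ j, (D j).level, Σ j, (D j).idx, fun p => (D p.1).term p.2⟩, fun j => ?_⟩
  refine Maps.vec (e := tuples 𝔐 Γ) (s := .RV (D j).level)
    (f := fun k i z => (D j).val (𝔐 i) z k) (fun k => ?_) (RVData.maps_base _)
  have hdvd : (D j).level ∣ ∏ j, (D j).level := Finset.dvd_prod_of_mem _ (Finset.mem_univ j)
  have h := DF.app (L := E.lang) (Sum.inl (LRVFunc.proj _ _ hdvd))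
    (g := fun _ i z => RVData.val ⟨∏ j, (D j).level, Σ j, (D j).idx, fun p => (D p.1).term p.2⟩
      (𝔐 i) z ⟨j, k⟩) (fun _ => RVData.df_val (ρ := ρ) _ _)
  exact h.congr fun i z => (proj_rv_of_isModel (h𝔐 i) hdvd _).symm

/-- Only `rv` leads from field arguments to a leading term, so the descent through `t` stops at
leading term variables, which lie in the image of `ρ`, at constants, or at `rv` of a field term,
which is put into `D`. -/
theorem exists_rvData_term (h𝔐 : ∀ i, (reduct (𝔐 i)).IsModel THen0.{v})
    (hρ : ∀ s, s ≠ .VF → Function.Surjective (ρ s)) {s : Srt} (t : Term E.lang Δ s) (hs : s ≠ .VF) :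
    ∃ D : RVData E Δ, (D.env 𝔐 ρ).DF (fun i z => t.eval (𝔐 i) z) := by
  induction t with
  | var x =>
    obtain ⟨y, rfl⟩ := hρ _ hs x
    exact ⟨⟨1, Empty, Empty.elim⟩, RVData.maps_base _ _ y⟩
  | app f ts ih =>
    by_cases h : ∀ j, E.lang.dom f j ≠ .VF
    · choose D hD using fun j => ih j (h j)
      obtain ⟨D', hD'⟩ := RVData.exists_upper (ρ := ρ) h𝔐 D
      exact ⟨D', DF.app (L := E.lang) f fun j => (hD j).comp (hD' j)⟩
    · rcases f with f | f | f
      · cases f with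
        | rv N => exact ⟨⟨N, Unit, fun _ => ts (0 : Fin 1)⟩,
            (RVData.df_val (ρ := ρ) _ ()).congr fun i z =>
              congrArg ((𝔐 i).func (Sum.inl (LRVFunc.rv N))) (funext fun j => by
                obtain rfl : j = (0 : Fin 1) := Subsingleton.elim (α := Fin 1) _ _
                rfl)⟩
        | zero => exact absurd rfl hs
        | one => exact absurd rfl hs
        | add => exact absurd rfl hs
        | neg => exact absurd rfl hs
        | mul => exact absurd rfl hs
        | zeroRV N => exact absurd (fun j => j.elim0) h
        | oneRV N => exact absurd (fun j => j.elim0) h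
        | mulRV N => exact absurd (fun j h => nomatch h) h
        | proj N M h' => exact absurd (fun j h => nomatch h) h
      · exact absurd (fun j => j.elim0) h
      · exact absurd (fun j h => nomatch h) h

/-- No relation symbol, old or new, has field arguments, so equality is the only atomic case to
convert. Variables outside the image of `ρ` survive only inside the terms of `D`. -/
theorem exists_rvData_formula (h𝔐 : ∀ i, (reduct (𝔐 i)).IsModel THen0.{v})
    (φ : Formula E.lang Δ) (hφ : φ.IsQF) (hρ : ∀ s, s ≠ .VF → Function.Surjective (ρ s)) :
    ∃ D : RVData E Δ, (D.env 𝔐 ρ).ES (fun _ => False) (fun i z => φ.Holds (𝔐 i) z) := by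
  induction φ with
  | falsum => exact ⟨⟨1, Empty, Empty.elim⟩, ES.false⟩
  | @eq Δ s t₁ t₂ =>
    by_cases hs : s = .VF
    · subst hs
      let t : Term E.lang Δ .VF := .app (L := E.lang) (Sum.inl LRVFunc.add)
        (fun j : Fin 2 => (Fin.cases t₁ (fun _ => .app (L := E.lang) (Sum.inl LRVFunc.neg)
          (fun _ => t₂)) j : Term E.lang Δ .VF))
      refine ⟨⟨1, Unit, fun _ => t⟩, ES.congr (ES.eq (RVData.df_val (ρ := ρ) _ ())
        (DF.app (L := E.lang) (Sum.inl (LRVFunc.zeroRV 1)) (g := fun j => j.elim0)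
          (fun j => j.elim0))) fun i z => ?_⟩
      refine (eq_iff_rv_sub_eq_zero (h𝔐 i) _ _).trans (Eq.congr ?_
        (congrArg ((𝔐 i).func (Sum.inl (LRVFunc.zeroRV 1))) (funext fun j => j.elim0)))
      refine congrArg ((𝔐 i).func (Sum.inl (LRVFunc.rv 1))) (funext fun _ =>
        congrArg ((𝔐 i).func (Sum.inl LRVFunc.add)) (funext fun j => ?_))
      exact Fin.cases (motive := fun j : Fin 2 => (Fin.cases (t₁.eval (𝔐 i) z) (fun _ =>
        (𝔐 i).func (Sum.inl LRVFunc.neg) (fun _ => t₂.eval (𝔐 i) z)) j : (𝔐 i).carrier .VF) =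
        Term.eval (𝔐 i) z (Fin.cases t₁ (fun _ => .app (L := E.lang) (Sum.inl LRVFunc.neg)
          (fun _ => t₂)) j : Term E.lang Δ .VF)) rfl (fun _ => rfl) j
    · obtain ⟨D₁, h₁⟩ := exists_rvData_term h𝔐 hρ t₁ hs
      obtain ⟨D₂, h₂⟩ := exists_rvData_term h𝔐 hρ t₂ hs
      obtain ⟨D, hD⟩ := RVData.exists_upper (ρ := ρ) h𝔐 (fun b : Bool => cond b D₁ D₂)
      exact ⟨D, ES.eq (h₁.comp (hD true)) (h₂.comp (hD false))⟩
  | rel r ts =>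
    have h : ∀ j, E.lang.relDom r j ≠ .VF := by
      rcases r with (N | N | ⟨N, d⟩) | r
      · exact fun j h => nomatch h
      · exact fun j h => nomatch h
      · exact fun j => Fin.cases (motive := fun j => LRVRel.dom (.P N d) j ≠ .VF)
          (fun h => nomatch h) (fun _ h => nomatch h) j
      · exact fun j h => nomatch h
    choose D hD using fun j => exists_rvData_term h𝔐 hρ (ts j) (h j)
    obtain ⟨D', hD'⟩ := RVData.exists_upper (ρ := ρ) h𝔐 D
    exact ⟨D', ES.rel r fun j => (hD j).comp (hD' j)⟩
  | not φ ih =>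
    obtain ⟨D, hD⟩ := ih (ρ := ρ) hφ hρ
    exact ⟨D, hD.not⟩
  | and φ ψ ih₁ ih₂ =>
    obtain ⟨D₁, h₁⟩ := ih₁ (ρ := ρ) hφ.1 hρ
    obtain ⟨D₂, h₂⟩ := ih₂ (ρ := ρ) hφ.2 hρ
    obtain ⟨D, hD⟩ := RVData.exists_upper (ρ := ρ) h𝔐 (fun b : Bool => cond b D₁ D₂)
    exact ⟨D, ES.and (h₁.comp (hD true)) (h₂.comp (hD false))⟩
  | or φ ψ ih₁ ih₂ =>
    obtain ⟨D₁, h₁⟩ := ih₁ (ρ := ρ) hφ.1 hρ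
    obtain ⟨D₂, h₂⟩ := ih₂ (ρ := ρ) hφ.2 hρ
    obtain ⟨D, hD⟩ := RVData.exists_upper (ρ := ρ) h𝔐 (fun b : Bool => cond b D₁ D₂)
    exact ⟨D, ES.or (fun _ _ h => h.elim) (h₁.comp (hD true)) (h₂.comp (hD false))⟩
  | all s φ => exact hφ.elim
  | ex s φ => exact hφ.elim

end LeadingTerm

namespace LeadingTerm

open ManySorted ManySorted.Env

variable {E : RVExpansion.{u}} {ι : Type*} {Γ Δ : List Srt} {𝔐 : ι → Struct.{u, w} E.lang}

/-! ### Elimination of the new constants from valued field terms -/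

/-- The value of a new constant. -/
def constVal (M : Struct.{u, w} E.lang) (c : E.Const) : M.carrier (E.constSort c) :=
  M.func (Sum.inr (Sum.inl c)) (fun j => j.elim0)

/-- The environment that consists of some constants and the variables `Γ`. -/
def constEnv (𝔐 : ι → Struct.{u, w} E.lang) (Γ : List Srt) :
    List E.Const → Env (fun i => reduct (𝔐 i)) (fun i => Tuple (𝔐 i).carrier Γ)
  | [] => ⟨Γ, fun _ z => z⟩
  | c :: C => ((constEnv 𝔐 Γ C).ext (E.constSort c)).pull (fun i z => (z, constVal (𝔐 i) c))

theorem constEnv_df_var (C : List E.Const) {s : Srt} (x : Var Γ s) :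
    (constEnv 𝔐 Γ C).DF (fun _ z => z s x) := by
  induction C with
  | nil => exact ⟨.var x, fun _ _ => rfl⟩
  | cons c C ih => exact (ih.comp (maps_ext _)).comp (maps_pull _ _)

theorem constEnv_df_const {C : List E.Const} {c : E.Const} (hc : c ∈ C) :
    (constEnv 𝔐 Γ C).DF (s := E.constSort c) (fun i _ => constVal (𝔐 i) c) := by
  induction hc with
  | head C => exact (DF.last (E.constSort c)).comp (maps_pull _ _)
  | tail b _ ih => exact (ih.comp (maps_ext _)).comp (maps_pull _ _)

theorem constEnv_maps {C C' : List E.Const} (h : C ⊆ C') :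
    (constEnv 𝔐 Γ C').Maps (constEnv 𝔐 Γ C) (fun _ z => z) := by
  induction C with
  | nil => exact fun s x => constEnv_df_var C' x
  | cons c C ih =>
    intro s x
    change Var (E.constSort c :: (constEnv 𝔐 Γ C).ctx) s at x
    cases x with
    | zero => exact constEnv_df_const (h List.mem_cons_self)
    | succ x => exact ih (fun a ha => h (List.mem_cons_of_mem _ ha)) s x

/-- The environment `constEnv`, for the expanded language. -/
def constEnvLang (𝔐 : ι → Struct.{u, w} E.lang) (Γ : List Srt) (C : List E.Const) :
    Env 𝔐 (fun i => Tuple (𝔐 i).carrier Γ) where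
  ctx := (constEnv 𝔐 Γ C).ctx
  val := (constEnv 𝔐 Γ C).val

theorem tuples_maps_constEnvLang (C : List E.Const) :
    (tuples 𝔐 Γ).Maps (constEnvLang 𝔐 Γ C) (fun _ z => z) := by
  induction C with
  | nil => exact maps_id
  | cons c C ih =>
    intro s x
    change Var (E.constSort c :: (constEnv 𝔐 Γ C).ctx) s at x
    cases x with
    | zero =>
      exact (DF.app (L := E.lang) (e := tuples 𝔐 Γ) (Sum.inr (Sum.inl c))
        (g := fun j => j.elim0) (fun j => j.elim0)).congr fun i _ =>
          congrArg ((𝔐 i).func (Sum.inr (Sum.inl c))) (funext fun j => j.elim0)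
    | succ x => exact ih s x

/-- The only new symbols in a field term are constants. With variables in their place the term
belongs to the language of leading terms, where the elimination is available. -/
theorem exists_constEnv_term {s : Srt} (t : Term E.lang (.VF :: Γ) s) (hs : s = .VF) :
    ∃ C : List E.Const, ((constEnv 𝔐 Γ C).ext .VF).DF
      (fun i p => t.eval (𝔐 i) (Tuple.cons p.2 p.1)) := by
  induction t with
  | var x =>
    cases x with
    | zero => exact ⟨[], DF.last Srt.VF⟩
    | succ x => exact ⟨[], (constEnv_df_var [] x).comp (maps_ext _)⟩
  | app f ts ih =>
    rcases f with f | c | f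
    · have h : ∀ j, f.dom j = .VF := by
        cases f with
        | zero => exact fun _ => rfl
        | one => exact fun _ => rfl
        | add => exact fun _ => rfl
        | neg => exact fun _ => rfl
        | mul => exact fun _ => rfl
        | rv N => exact fun _ => rfl
        | zeroRV N => cases hs
        | oneRV N => cases hs
        | mulRV N => cases hs
        | proj N M h => cases hs
      choose C hC using fun j => ih j (h j)
      refine ⟨(List.finRange _).flatMap C, DF.app (L := LRV) f fun j => ?_⟩
      refine (hC j).comp ((constEnv_maps fun a ha => ?_).ext .VF)
      exact List.mem_flatMap.2 ⟨j, List.mem_finRange j, ha⟩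
    · exact ⟨[c], ((constEnv_df_const List.mem_cons_self).comp (maps_ext _)).congr fun i p =>
        congrArg ((𝔐 i).func (Sum.inr (Sum.inl c))) (funext fun j => j.elim0)⟩
    · cases hs

/-! ### Elimination of the quantifiers over the valued field -/

/-- The formula `∃ a, φ` is split as `∃ ζ, θ(z, ζ) ∧ ∃ a, ⋀ rv (tₖ(a, z)) = ζₖ`. The new function
and relation symbols stay in the quantifier-free `θ`, and the second conjunct has an ∃-simple
equivalent `χ`. -/
theorem exists_simple_of_qf (h𝔐 : ∀ i, (reduct (𝔐 i)).IsModel THen0.{v})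
    {φ : Formula E.lang (.VF :: Γ)} (hφ : φ.IsQF) :
    ∃ ψ : Formula E.lang Γ, IsExistsSimple ψ ∧
      ∀ i z, ψ.Holds (𝔐 i) z ↔ ∃ a : (𝔐 i).carrier .VF, φ.Holds (𝔐 i) (Tuple.cons a z) := by
  obtain ⟨D, θ, hθ, hθφ⟩ := exists_rvData_formula (𝔐 := 𝔐) (Γ := Γ) h𝔐 φ hφ
    (ρ := fun s x => Var.succ x) (fun s hs x => by
      cases x with
      | zero => exact absurd rfl hs
      | succ y => exact ⟨y, rfl⟩)
  choose C hC using fun k => exists_constEnv_term (𝔐 := 𝔐) (D.term k) rfl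
  let C' := (Finset.univ : Finset D.idx).toList.flatMap C
  have hC' : ∀ k, ((constEnv 𝔐 Γ C').ext .VF).DF
      (fun i p => (D.term k).eval (𝔐 i) (Tuple.cons p.2 p.1)) := by
    refine fun k => (hC k).comp ((constEnv_maps fun a ha => ?_).ext .VF)
    exact List.mem_flatMap.2 ⟨k, Finset.mem_toList.2 (Finset.mem_univ k), ha⟩
  choose t ht using hC'
  obtain ⟨χ, hχ, hχt⟩ := exists_simple_leadingTermsFormula.{v, w} D.level t
  have h1 : ((tuples 𝔐 Γ).vec D.idx (.RV D.level)).ES (fun s => s ≠ .VF)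
      (fun i p => θ.Holds (𝔐 i) (((tuples 𝔐 Γ).vec D.idx (.RV D.level)).val i p)) :=
    ES.of_false ⟨θ, hθ, fun _ _ => Iff.rfl⟩
  have h2 : ((constEnvLang 𝔐 Γ C').vec D.idx (.RV D.level)).ES (fun s => s ≠ .VF)
      (fun i p => χ.Holds (reduct (𝔐 i))
        (((constEnvLang 𝔐 Γ C').vec D.idx (.RV D.level)).val i p)) :=
    ⟨liftFormula χ, isExistentialOver_liftFormula hχ, fun i p => holds_liftFormula (𝔐 i) χ _⟩
  -- The constants are put back for the variables that replaced them.
  have h3 : ((tuples 𝔐 Γ).vec D.idx (.RV D.level)).Maps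
      ((constEnvLang 𝔐 Γ C').vec D.idx (.RV D.level)) (fun i p => (p.1, fun k => p.2 k)) :=
    Maps.vec (fun k => DF.coord (Srt.RV D.level) k)
      ((tuples_maps_constEnvLang C').comp (maps_vec _ _))
  obtain ⟨ψ, hψ, hψφ⟩ := ES.exVec (e := tuples 𝔐 Γ) (κ := D.idx) (s := Srt.RV D.level)
    (Q := fun s => s ≠ .VF)
    (X := fun i z ζ => θ.Holds (𝔐 i) (((tuples 𝔐 Γ).vec D.idx (.RV D.level)).val i (z, ζ)) ∧
      χ.Holds (reduct (𝔐 i))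
        (((constEnvLang 𝔐 Γ C').vec D.idx (.RV D.level)).val i (z, fun k => ζ k)))
    Srt.noConfusion (h1.and (h2.comp h3))
  refine ⟨ψ, hψ, fun i z => (hψφ i z).trans ?_⟩
  have h4 : ∀ ζ : D.idx → (𝔐 i).carrier (.RV D.level), χ.Holds (reduct (𝔐 i))
      (((constEnvLang 𝔐 Γ C').vec D.idx (.RV D.level)).val i (z, fun k => ζ k)) ↔
      ∃ a : (𝔐 i).carrier .VF, ∀ k, D.val (𝔐 i) (Tuple.cons a z) k = ζ k := by
    intro ζ
    refine (hχt _ (h𝔐 i) _).trans ((holds_leadingTermsFormula (reduct (𝔐 i)) D.level t ζ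
      ((constEnv 𝔐 Γ C').val i z)).trans ?_)
    exact exists_congr fun a => forall_congr' fun k => Eq.congr
      (congrArg ((𝔐 i).func (Sum.inl (LRVFunc.rv D.level))) (funext fun _ => ht k i (z, a))) rfl
  constructor
  · rintro ⟨ζ, h5, h6⟩
    obtain ⟨a, ha⟩ := (h4 ζ).1 h6
    obtain rfl : D.val (𝔐 i) (Tuple.cons a z) = ζ := funext ha
    exact ⟨a, (hθφ i (Tuple.cons a z)).1 h5⟩
  · rintro ⟨a, ha⟩
    exact ⟨D.val (𝔐 i) (Tuple.cons a z), (hθφ i (Tuple.cons a z)).2 ha, (h4 _).2 ⟨a, fun k => rfl⟩⟩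

/-- The substitution induced by `σ` when a variable is inserted after the first one. -/
def liftSubstSnd {L : Signature.{u} Srt} (σ : ∀ s, Var Δ s → Term L (.VF :: Γ) s) (s : Srt) :
    ∀ t, Var (s :: Δ) t → Term L (.VF :: s :: Γ) t
  | _, .zero => .var (.succ .zero)
  | _, .succ x => (σ _ x).subst (fun _ y => match y with
    | .zero => .var .zero
    | .succ y => .var (.succ (.succ y)))

theorem eval_liftSubstSnd {L : Signature.{u} Srt} (M : Struct.{u, w} L)
    (σ : ∀ s, Var Δ s → Term L (.VF :: Γ) s) (s : Srt) (a : M.carrier .VF) (b : M.carrier s)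
    (z : Tuple M.carrier Γ) :
    (fun t x => (liftSubstSnd σ s t x).eval M (Tuple.cons a (Tuple.cons b z))) =
      Tuple.cons b (fun t x => (σ t x).eval M (Tuple.cons a z)) := by
  funext t x
  cases x with
  | zero => rfl
  | succ x =>
    refine (Term.eval_subst M _ _ _).trans (congrArg (fun v => (σ t x).eval M v) ?_)
    funext s y
    cases y <;> rfl

/-- The field quantifier is moved inwards past the leading term quantifiers. The substitution `σ`
records the place of its variable, which is no longer the first one after a quantifier is crossed.
-/
theorem exists_simple_of_simple (h𝔐 : ∀ i, (reduct (𝔐 i)).IsModel THen0.{v})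
    {φ : Formula E.lang Δ} (hφ : IsExistsSimple φ) :
    ∀ {Γ : List Srt} (σ : ∀ s, Var Δ s → Term E.lang (.VF :: Γ) s),
      ∃ ψ : Formula E.lang Γ, IsExistsSimple ψ ∧ ∀ i z, ψ.Holds (𝔐 i) z ↔
        ∃ a : (𝔐 i).carrier .VF, φ.Holds (𝔐 i) (fun s x => (σ s x).eval (𝔐 i) (Tuple.cons a z)) := by
  unfold IsExistsSimple at hφ
  induction hφ with
  | qf h =>
    intro Γ σ
    obtain ⟨ψ, h₁, h₂⟩ := exists_simple_of_qf h𝔐 (h.subst σ)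
    exact ⟨ψ, h₁, fun i z => (h₂ i z).trans (exists_congr fun a => Formula.holds_subst _ _ _ _)⟩
  | @ex Δ s φ hs _ ih =>
    intro Γ σ
    obtain ⟨ψ, h₁, h₂⟩ := ih (liftSubstSnd σ s)
    refine ⟨.ex s ψ, .ex hs h₁, fun i z => ?_⟩
    refine (exists_congr fun b => h₂ i (Tuple.cons b z)).trans (exists_comm.trans ?_)
    refine exists_congr fun a => exists_congr fun b => ?_
    rw [eval_liftSubstSnd]

theorem exists_simple_of_existential (h𝔐 : ∀ i, (reduct (𝔐 i)).IsModel THen0.{v})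
    {φ : Formula E.lang Γ} (hφ : φ.IsExistential) :
    ∃ ψ : Formula E.lang Γ, IsExistsSimple ψ ∧ ∀ i z, φ.Holds (𝔐 i) z ↔ ψ.Holds (𝔐 i) z := by
  unfold Formula.IsExistential at hφ
  induction hφ with
  | qf h => exact ⟨_, .qf h, fun _ _ => Iff.rfl⟩
  | @ex Γ s φ _ _ ih =>
    obtain ⟨ψ, h₁, h₂⟩ := ih
    by_cases hs : s = .VF
    · subst hs
      obtain ⟨χ, h₃, h₄⟩ := exists_simple_of_simple h𝔐 h₁ (fun _ x => .var x)
      exact ⟨χ, h₃, fun i z => (exists_congr fun a => h₂ i _).trans (h₄ i z).symm⟩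
    · exact ⟨.ex s ψ, .ex hs h₁, fun i z => exists_congr fun a => h₂ i _⟩

/-- Taking all models of `T` as the family of structures makes `ψ` independent of the model. -/
theorem exists_simple_equivModulo {T : Theory E.lang} (hT : Expands.{u, w} T THen0.{v})
    {φ : Formula E.lang Γ} (hφ : φ.IsExistential) :
    ∃ ψ : Formula E.lang Γ, IsExistsSimple ψ ∧ EquivModulo.{u, w} T φ ψ := by
  obtain ⟨ψ, h₁, h₂⟩ := exists_simple_of_existential
    (𝔐 := fun M : {M : Struct.{u, w} E.lang // M.IsModel T} => M.1) (fun M => hT M.1 M.2) hφ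
  exact ⟨ψ, h₁, fun M hM => Set.ext fun z => h₂ ⟨M, hM⟩ z⟩

/-! ### The expansion without new symbols -/

/-- The expansion without new symbols. -/
def emptyExpansion : RVExpansion.{0} where
  Const := Empty
  constSort := Empty.elim
  Func := Empty
  arity := Empty.elim
  dom f := f.elim
  cod := Empty.elim
  Rel := Empty
  relArity := Empty.elim
  relDom r := r.elim

/-- A structure for the language of leading terms as a structure for the empty expansion. -/
def expandEmpty (M : Struct.{0, w} LRV) : Struct.{0, w} emptyExpansion.lang where
  carrier := M.carrier
  func
    | .inl f => M.func f
    | .inr (.inl c) => c.elim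
    | .inr (.inr f) => f.elim
  rel
    | .inl r => M.rel r
    | .inr r => r.elim

/-- The inverse of `liftTerm` for the empty expansion. -/
def lowerTerm {Γ : List Srt} : {s : Srt} → Term emptyExpansion.lang Γ s → Term LRV Γ s
  | _, .var x => .var x
  | _, .app (Sum.inl f) ts => .app (L := LRV) f (fun i => lowerTerm (ts i))
  | _, .app (Sum.inr (Sum.inl c)) _ => c.elim
  | _, .app (Sum.inr (Sum.inr f)) _ => f.elim

/-- The inverse of `liftFormula` for the empty expansion. -/
def lowerFormula : {Γ : List Srt} → Formula emptyExpansion.lang Γ → Formula LRV Γ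
  | _, .falsum => .falsum
  | _, .eq t₁ t₂ => .eq (lowerTerm t₁) (lowerTerm t₂)
  | _, .rel (Sum.inl r) ts => .rel (L := LRV) r (fun i => lowerTerm (ts i))
  | _, .rel (Sum.inr r) _ => r.elim
  | _, .not φ => .not (lowerFormula φ)
  | _, .and φ ψ => .and (lowerFormula φ) (lowerFormula ψ)
  | _, .or φ ψ => .or (lowerFormula φ) (lowerFormula ψ)
  | _, .all s φ => .all s (lowerFormula φ)
  | _, .ex s φ => .ex s (lowerFormula φ)

theorem eval_lowerTerm (M : Struct.{0, w} LRV) {Γ : List Srt} (v : Tuple M.carrier Γ) {s : Srt}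
    (t : Term emptyExpansion.lang Γ s) : (lowerTerm t).eval M v = t.eval (expandEmpty M) v := by
  induction t with
  | var x => rfl
  | app f ts ih =>
    rcases f with f | c | f
    · exact congrArg (M.func f) (funext ih)
    · exact c.elim
    · exact f.elim

theorem holds_lowerFormula (M : Struct.{0, w} LRV) {Γ : List Srt}
    (φ : Formula emptyExpansion.lang Γ) :
    ∀ v : Tuple M.carrier Γ, (lowerFormula φ).Holds M v ↔ φ.Holds (expandEmpty M) v := by
  induction φ with
  | falsum => exact fun v => Iff.rfl
  | eq t₁ t₂ => exact fun v => Eq.congr (eval_lowerTerm M v t₁) (eval_lowerTerm M v t₂)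
  | rel r ts =>
    rcases r with r | r
    · exact fun v => iff_of_eq (congrArg (M.rel r) (funext fun i => eval_lowerTerm M v (ts i)))
    · exact r.elim
  | not φ ih => exact fun v => not_congr (ih v)
  | and φ ψ ih₁ ih₂ => exact fun v => and_congr (ih₁ v) (ih₂ v)
  | or φ ψ ih₁ ih₂ => exact fun v => or_congr (ih₁ v) (ih₂ v)
  | all s φ ih => exact fun v => forall_congr' fun a => ih (Tuple.cons a v)
  | ex s φ ih => exact fun v => exists_congr fun a => ih (Tuple.cons a v)

theorem isQF_lowerFormula {Γ : List Srt} {φ : Formula emptyExpansion.lang Γ} (h : φ.IsQF) :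
    (lowerFormula φ).IsQF := by
  induction φ with
  | falsum => trivial
  | eq t₁ t₂ => trivial
  | rel r ts =>
    rcases r with r | r
    · trivial
    · exact r.elim
  | not φ ih => exact ih h
  | and φ ψ ih₁ ih₂ => exact ⟨ih₁ h.1, ih₂ h.2⟩
  | or φ ψ ih₁ ih₂ => exact ⟨ih₁ h.1, ih₂ h.2⟩
  | all s φ => exact h.elim
  | ex s φ => exact h.elim

theorem isExistentialOver_lowerFormula {Q : Srt → Prop} {Γ : List Srt}
    {φ : Formula emptyExpansion.lang Γ} (h : φ.IsExistentialOver Q) :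
    (lowerFormula φ).IsExistentialOver Q := by
  induction h with
  | qf h => exact .qf (isQF_lowerFormula h)
  | ex hs _ ih => exact .ex hs ih

theorem exists_simple_equivModulo_tHen0 {φ : Formula LRV Γ} (hφ : φ.IsExistential) :
    ∃ ψ : Formula LRV Γ, IsExistsSimple ψ ∧ EquivModulo.{0, w} THen0.{v} φ ψ := by
  -- With this choice of `T` every model of the original theory becomes a model of `T` under
  -- `expandEmpty`.
  let T : Theory emptyExpansion.lang := liftFormula '' THen0.{v}
  have hT : Expands.{0, w} T THen0.{v} := fun M hM σ hσ =>
    (holds_liftFormula M σ _).1 (hM _ (Set.mem_image_of_mem _ hσ))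
  obtain ⟨ψ, h₁, h₂⟩ := exists_simple_equivModulo hT (isExistentialOver_liftFormula hφ)
  refine ⟨lowerFormula ψ, isExistentialOver_lowerFormula h₁, fun M hM => Set.ext fun z => ?_⟩
  have hM' : (expandEmpty M).IsModel T := by
    rintro _ ⟨σ, hσ, rfl⟩
    exact (holds_liftFormula (expandEmpty M) σ _).2 (hM σ hσ)
  have h3 := Set.ext_iff.1 (h₂ (expandEmpty M) hM') z
  exact (holds_liftFormula (expandEmpty M) φ z).symm.trans (h3.trans (holds_lowerFormula M ψ z).symm)

end LeadingTerm

theorem mainTheorem3 :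
    -- reduction of existential quantifiers, for every expansion `E` and every theory `T`
    (∀ (E : LeadingTerm.RVExpansion.{u}) (T : ManySorted.Theory E.lang),
      LeadingTerm.Expands.{u, w} T LeadingTerm.THen0.{v} →
      -- every existential formula is equivalent to one without valued field quantifiers
      (∀ (Γ : List LeadingTerm.Srt) (φ : ManySorted.Formula E.lang Γ), φ.IsExistential →
        ∃ ψ : ManySorted.Formula E.lang Γ,
          LeadingTerm.IsExistsSimple ψ ∧ ManySorted.EquivModulo.{u, w} T φ ψ) ∧
      -- every existentially definable set is `∃`-simple
      (∀ (𝒦 : Set (ManySorted.Struct.{u, w} E.lang)), (∀ M ∈ 𝒦, M.IsModel T) →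
        ∀ (Γ : List LeadingTerm.Srt) (X : (M : 𝒦) → Set (ManySorted.Tuple M.1.carrier Γ)),
          LeadingTerm.IsExistentiallyDefinable 𝒦 X → LeadingTerm.IsExistsSimpleSet 𝒦 X)) ∧
    -- the instance without new symbols
    (∀ (Γ : List LeadingTerm.Srt) (φ : ManySorted.Formula LeadingTerm.LRV Γ), φ.IsExistential →
      ∃ ψ : ManySorted.Formula LeadingTerm.LRV Γ, LeadingTerm.IsExistsSimple ψ ∧
        ManySorted.EquivModulo.{0, w} LeadingTerm.THen0.{v} φ ψ) := by
  refine ⟨fun E T hT => ?_, fun Γ φ hφ => LeadingTerm.exists_simple_equivModulo_tHen0 hφ⟩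
  have h := fun (Γ : List LeadingTerm.Srt) (φ : ManySorted.Formula E.lang Γ)
    (hφ : φ.IsExistential) => LeadingTerm.exists_simple_equivModulo hT hφ
  refine ⟨h, fun 𝒦 h𝒦 Γ X ⟨φ, hφ, hX⟩ => ?_⟩
  obtain ⟨ψ, hψ, hφψ⟩ := h Γ φ hφ
  exact ⟨ψ, hψ, fun M => (hX M).trans (hφψ M.1 (h𝒦 M.1 M.2))⟩
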